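/- Let $\varrho>0$ (in the application, $\varrho=\varrho_\Omega=\sup_{z\in\Omega}|z|$ for a bounded domain $\Omega\subset\mathbb C$ that is star-shaped with respect to $0$). Let $q_f\in C^1[0,\varrho]$ be complex-valued, and let $f\in C^2[0,\varrho]$ be complex-valued with $f(r)\neq 0$ for all $r\in[0,\varrho]$, $f(0)=1$, and $$f''(r)+\tfrac1r f'(r)-q_f(r)f(r)=0,\qquad 0<r<\varrho .$$ Put $q_{1/f}=2\left(\frac{f'}{f}\right)^2-q_f$. For a potential $q\in\{q_f,q_{1/f}\}$ consider the Goursat problem $$r\,(G_{rr}-qG)-G_r+2(1-t)G_{rt}=0\ \text{ on }(0,\varrho)\times(0,1),\qquad G(r,0)=\int_0^r\tau q(\tau)\,d\tau,\qquad G(0,t)=0,$$ for $G$ continuous on $[0,\varrho]\times[0,1]$ and of class $C^2$ in the interior. For both potentials it has exactly one solution; denote the solutions by $G^f$ (for $q_f$) and $G^{1/f}$ (for $q_{1/f}$). For $g\in\{f,1/f\}$ and a continuous function $h$ of the radius set $$\mathbf T_g h(r)=h(r)+\int_0^1\sigma\,G^g(r,1-\sigma^2)\,h(\sigma^2r)\,d\sigma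 ,$$ and let $\mathbf D_g=\frac{r}{g}\frac{d}{dr}g$, that is $\mathbf D_gv(r)=\frac{r}{g(r)}\,(gv)'(r)$ (one-sided derivative at $r=0$), so that $\mathbf D_1=r\frac{d}{dr}$. Then: 1. For every polynomial $p$ with complex coefficients and every $r\in[0,\varrho]$, $$\mathbf T_{1/f}\,p(r)=\frac1{f(r)}\left(\int_0^r\frac{f(s)\,\mathbf T_f[s\,p'(s)]}{s}\,ds+p(0)\right),$$ the integrand being integrable on $[0,r]$. 2. For every complex-valued $u\in C^1[0,\varrho)$ and every $r\in[0,\varrho)$, $$\mathbf T_{1/f}\,u(r)=\frac1{f(r)}\left(\int_0^r\frac{f(s)\,\mathbf T_f[s\,u'(s)]}{s}\,ds+u(0)\right),$$ the integrand being integrable on $[0,r]$. 3. For every complex-valued $u\in C^1[0,\varrho)$, the functions $\mathbf T_fu$ and $\mathbf T_{1/f}u$ belong to $C^1[0,\varrho)$, and on $[0,\varrho)$ $$\mathbf D_f\mathbf T_{1/f}u=\mathbf T_f\mathbf D_1u,\qquad \mathbf D_{1/f}\mathbf T_fu=\mathbf T_{1/f}\mathbf D_1u .$$ -/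

import Mathlib

open Set

namespace RadialVekua

/-- `G` is a classical solution on `[0, ρ] × [0, 1]` of the Goursat problem
`r (G_rr - q(r) G) - G_r + 2 (1 - t) G_rt = 0`, `G(r, 0) = ∫_0^r τ q(τ) dτ`, `G(0, t) = 0`:
continuous on the closed rectangle and twice continuously differentiable in its interior, where
the differential equation holds. -/
structure IsTransmutationKernel (ρ : ℝ) (q : ℝ → ℂ) (G : ℝ → ℝ → ℂ) : Prop where
  continuousOn : ContinuousOn (fun p : ℝ × ℝ => G p.1 p.2) (Icc 0 ρ ×ˢ Icc 0 1)
  contDiffOn : ContDiffOn ℝ 2 (fun p : ℝ × ℝ => G p.1 p.2) (Ioo 0 ρ ×ˢ Ioo 0 1)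
  pde : ∀ r ∈ Ioo 0 ρ, ∀ t ∈ Ioo (0 : ℝ) 1,
    (r : ℂ) * (deriv (fun x => deriv (fun y => G y t) x) r - q r * G r t)
      - deriv (fun x => G x t) r
      + 2 * (1 - (t : ℂ)) * deriv (fun s => deriv (fun x => G x s) r) t = 0
  initial_t : ∀ r ∈ Icc 0 ρ, G r 0 = ∫ τ in (0 : ℝ)..r, (τ : ℂ) * q τ
  initial_r : ∀ t ∈ Icc (0 : ℝ) 1, G 0 t = 0

/-- The Goursat problem has a solution, and only one on the rectangle `[0, ρ] × [0, 1]`. -/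
def KernelWellPosed (ρ : ℝ) (q : ℝ → ℂ) : Prop :=
  (∃ G, IsTransmutationKernel ρ q G) ∧
    ∀ G H, IsTransmutationKernel ρ q G → IsTransmutationKernel ρ q H →
      ∀ r ∈ Icc 0 ρ, ∀ t ∈ Icc (0 : ℝ) 1, G r t = H r t

open Classical in
/-- The kernel of the transmutation operator for the potential `q` on `[0, ρ]`. -/
noncomputable def kernel (ρ : ℝ) (q : ℝ → ℂ) : ℝ → ℝ → ℂ :=
  if h : ∃ G, IsTransmutationKernel ρ q G then h.choose else 0

/-- The transmutation operator for the potential `q`, on functions of the radius: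
`T h(r) = h(r) + ∫_0^1 σ G(r, 1 - σ²) h(σ² r) dσ`. -/
noncomputable def transmutation (ρ : ℝ) (q : ℝ → ℂ) (h : ℝ → ℂ) (r : ℝ) : ℂ :=
  h r + ∫ σ in (0 : ℝ)..1, (σ : ℂ) * kernel ρ q r (1 - σ ^ 2) * h (σ ^ 2 * r)

/-- The Darboux transformed potential `q_{1/f} = 2 (f'/f)² - q` on `[0, ρ]`. -/
noncomputable def darbouxPotential (ρ : ℝ) (f q : ℝ → ℂ) (r : ℝ) : ℂ :=
  2 * (derivWithin f (Icc 0 ρ) r / f r) ^ 2 - q r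

/-- The operator `D_f = (r / f) (d/dr) f` on functions on `[0, ρ)`; the derivative at `0` is
one-sided. -/
noncomputable def darbouxD (ρ : ℝ) (f g : ℝ → ℂ) (r : ℝ) : ℂ :=
  (r : ℂ) / f r * derivWithin (fun s => f s * g s) (Ico 0 ρ) r

end RadialVekua

namespace RadialVekua

open MeasureTheory Filter Topology Function BoundedContinuousFunction

/-! ### Parametric integrals of continuous functions -/

/-! Put a = √(1 - t) and K(r, a) = G(r, 1 - a²). The coordinates θ = -log a, w = ra are
characteristic: J = a²K satisfies J_θw = w e^{2θ} q(we^θ) J with J(0, w) = ∫_0^w v q(v) dv and J(θ,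
0) = 0. The doubly integrated equation is solved by a contraction in an exponentially weighted norm,
with K continuous up to a = 0 (`exists_isProfile`); one bootstrap makes the kernel C² when q is C¹
(`IsProfile.isTransmutationKernel`). Uniqueness (`IsTransmutationKernel.eqOn`) has no boundary
regularity to work with; it uses that G_r / r solves an ordinary differential equation along the
characteristics r²(1 - t) = const. Hence the kernel obtained by choice is the explicit K.

The heart is a first order relation between the kernels K of q = q_f and K' of p = q_{1/f}: with ψ =
f'/f, ∂_a(a²(K' - K)) = 2ar(K'_r + ψK') (`hasDerivAt_sq_mul_sub`). It is the vanishing of two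
residuals X, Y for which X_θ = φ w⁻² Y and Y_w = φ w X, where φ = rψ(r) at r = we^θ. This closed
system needs only q + p = 2ψ² and (rψ)' = r(q - ψ²). Since X = 0 at θ = 0 and Y = 0 at w = 0, a
Gronwall iteration in powers of w gives X = Y = 0.

Multiplying the relation by u(σ²r) and integrating by parts in σ = a yields (f T_{1/f} u)' = f r⁻¹
T_f[s u'] (`mul_profileOp_eq`). The right side extends continuously to r = 0, so the representation,
the C¹ regularity and the first intertwining relation all follow. The second one is the first with f
replaced by 1/f, which exchanges the potentials and changes the sign of ψ. -/

theorem hasDerivAt_intervalIntegral_of_continuous {F F' : ℝ → ℝ → ℂ} (hF : Continuous ↿F)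
    (hF' : Continuous ↿F') (h : ∀ x t, HasDerivAt (fun x => F x t) (F' x t) x) (a b x₀ : ℝ) :
    HasDerivAt (fun x => ∫ t in a..b, F x t) (∫ t in a..b, F' x₀ t) x₀ := by
  have hK : IsCompact (Icc (x₀ - 1) (x₀ + 1) ×ˢ uIcc a b) := isCompact_Icc.prod isCompact_uIcc
  obtain ⟨C, hC⟩ := hK.exists_bound_of_continuousOn hF'.continuousOn
  have hc : ∀ x, Continuous (F x) := fun x => hF.comp (by fun_prop : Continuous fun t => (x, t))
  have hc' : ∀ x, Continuous (F' x) := fun x => hF'.comp (by fun_prop : Continuous fun t => (x, t))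
  refine (intervalIntegral.hasDerivAt_integral_of_dominated_loc_of_deriv_le
    (s := Icc (x₀ - 1) (x₀ + 1)) (bound := fun _ => C) (Icc_mem_nhds (by linarith) (by linarith))
    (.of_forall fun x => (hc x).aestronglyMeasurable) ((hc x₀).intervalIntegrable _ _)
    (hc' x₀).aestronglyMeasurable ?_ intervalIntegrable_const ?_).2
  · exact .of_forall fun t ht x hx => hC (x, t) ⟨hx, uIoc_subset_uIcc ht⟩
  · exact .of_forall fun t _ x _ => h x t

theorem hasFDerivAt_of_partials {F F₁ F₂ : ℝ → ℝ → ℂ} (h₁ : ∀ x y, HasDerivAt (fun x => F x y) (F₁ x y) x)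
    (h₂ : ∀ x y, HasDerivAt (F x) (F₂ x y) y) (c₁ : Continuous ↿F₁) (c₂ : Continuous ↿F₂)
    (u : ℝ × ℝ) :
    HasFDerivAt ↿F ((ContinuousLinearMap.toSpanSingleton ℝ (F₁ u.1 u.2)).coprod
      (ContinuousLinearMap.toSpanSingleton ℝ (F₂ u.1 u.2))) u := by
  have hc : Continuous (fun z : ℂ => ContinuousLinearMap.toSpanSingleton ℝ z) :=
    (ContinuousLinearMap.toSpanSingletonCLE (𝕜 := ℝ) (E := ℂ)).continuous
  refine (hasStrictFDerivAt_uncurry_coprod (f := F)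
    (f₁ := fun x y => ContinuousLinearMap.toSpanSingleton ℝ (F₁ x y))
    (f₂ := fun x y => ContinuousLinearMap.toSpanSingleton ℝ (F₂ x y)) (u := u)
    (.of_forall fun v => ?_) (.of_forall fun v => ?_) ?_ ?_).hasFDerivAt
  · exact (h₁ v.1 v.2).hasFDerivAt
  · exact (h₂ v.1 v.2).hasFDerivAt
  · exact (hc.comp c₁).continuousAt
  · exact (hc.comp c₂).continuousAt

theorem contDiff_succ_of_partials {n : ℕ} {F F₁ F₂ : ℝ → ℝ → ℂ}
    (h₁ : ∀ x y, HasDerivAt (fun x => F x y) (F₁ x y) x)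
    (h₂ : ∀ x y, HasDerivAt (F x) (F₂ x y) y) (c₁ : ContDiff ℝ n ↿F₁) (c₂ : ContDiff ℝ n ↿F₂) :
    ContDiff ℝ (n + 1) ↿F := by
  refine contDiff_succ_iff_hasFDerivAt.2 ⟨_, ?_, fun u =>
    hasFDerivAt_of_partials h₁ h₂ c₁.continuous c₂.continuous u⟩
  have e : ∀ z : ℂ, ContinuousLinearMap.toSpanSingleton ℝ z =
      ContinuousLinearMap.toSpanSingletonCLE (𝕜 := ℝ) (E := ℂ) z := fun z => rfl
  have h : (fun u : ℝ × ℝ => (ContinuousLinearMap.toSpanSingleton ℝ (F₁ u.1 u.2)).coprod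
      (ContinuousLinearMap.toSpanSingleton ℝ (F₂ u.1 u.2))) = fun u : ℝ × ℝ =>
      (ContinuousLinearMap.toSpanSingletonCLE (𝕜 := ℝ) (E := ℂ) (↿F₁ u)).comp
        (ContinuousLinearMap.fst ℝ ℝ ℝ) +
      (ContinuousLinearMap.toSpanSingletonCLE (𝕜 := ℝ) (E := ℂ) (↿F₂ u)).comp
        (ContinuousLinearMap.snd ℝ ℝ ℝ) := by
    ext u <;> simp [HasUncurry.uncurry]
  rw [h]
  exact (((ContinuousLinearEquiv.contDiff _).comp c₁).clm_comp contDiff_const).add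
    (((ContinuousLinearEquiv.contDiff _).comp c₂).clm_comp contDiff_const)

theorem continuous_integral_left {Ψ : ℝ → ℝ → ℂ} (hΨ : Continuous ↿Ψ) :
    Continuous ↿(fun θ w : ℝ => ∫ η in (0 : ℝ)..θ, Ψ η w) :=
  intervalIntegral.continuous_parametric_intervalIntegral_of_continuous
    (f := fun (p : ℝ × ℝ) η => Ψ η p.2)
    (hΨ.comp (by fun_prop : Continuous fun z : (ℝ × ℝ) × ℝ => (z.2, z.1.2))) continuous_fst

theorem continuous_integral_right {Ψ : ℝ → ℝ → ℂ} (hΨ : Continuous ↿Ψ) :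
    Continuous ↿(fun θ w : ℝ => ∫ v in (0 : ℝ)..w, Ψ θ v) :=
  intervalIntegral.continuous_parametric_intervalIntegral_of_continuous
    (f := fun (p : ℝ × ℝ) v => Ψ p.1 v)
    (hΨ.comp (by fun_prop : Continuous fun z : (ℝ × ℝ) × ℝ => (z.1.1, z.2))) continuous_snd

theorem hasDerivAt_integral_of_continuous {g : ℝ → ℂ} (hg : Continuous g) (a x : ℝ) :
    HasDerivAt (fun x => ∫ t in a..x, g t) (g x) x :=
  intervalIntegral.integral_hasDerivAt_right (hg.intervalIntegrable _ _)
    hg.aestronglyMeasurable.stronglyMeasurableAtFilter hg.continuousAt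

theorem contDiff_one_integral_left {Ψ : ℝ → ℝ → ℂ} (hΨ : ContDiff ℝ 1 ↿Ψ) :
    ContDiff ℝ 1 ↿(fun θ w : ℝ => ∫ η in (0 : ℝ)..θ, Ψ η w) := by
  have hd : ∀ η w, HasDerivAt (fun w => Ψ η w) (fderiv ℝ ↿Ψ (η, w) (0, 1)) w := fun η w => by
    have h := (hΨ.differentiable one_ne_zero (η, w)).hasFDerivAt
    exact h.comp_hasDerivAt w ((hasDerivAt_const w η).prodMk (hasDerivAt_id w))
  have hc : Continuous fun p : ℝ × ℝ => fderiv ℝ ↿Ψ p (0, 1) :=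
    (hΨ.continuous_fderiv one_ne_zero).clm_apply continuous_const
  refine contDiff_succ_of_partials (n := 0) (F₁ := Ψ)
    (F₂ := fun θ w => ∫ η in (0 : ℝ)..θ, fderiv ℝ ↿Ψ (η, w) (0, 1)) ?_ ?_ ?_ ?_
  · exact fun θ w => hasDerivAt_integral_of_continuous
      (hΨ.continuous.comp (by fun_prop : Continuous fun t => (t, w))) 0 θ
  · intro θ w
    refine hasDerivAt_intervalIntegral_of_continuous (F := fun w η => Ψ η w)
      (F' := fun w η => fderiv ℝ ↿Ψ (η, w) (0, 1)) ?_ ?_ (fun w η => hd η w) 0 θ w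
    · exact hΨ.continuous.comp continuous_swap
    · exact hc.comp continuous_swap
  · exact contDiff_zero.2 hΨ.continuous
  · exact contDiff_zero.2 (continuous_integral_left (Ψ := fun η w => fderiv ℝ ↿Ψ (η, w) (0, 1)) hc)

theorem contDiff_one_integral_right {Ψ : ℝ → ℝ → ℂ} (hΨ : ContDiff ℝ 1 ↿Ψ) :
    ContDiff ℝ 1 ↿(fun θ w : ℝ => ∫ v in (0 : ℝ)..w, Ψ θ v) :=
  (contDiff_one_integral_left (Ψ := fun v θ => Ψ θ v) (hΨ.comp (contDiff_snd.prodMk contDiff_fst))).comp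
    (contDiff_snd.prodMk contDiff_fst)

/-- The double integral solving the Goursat problem `J_θw = Ψ` with zero data. -/
noncomputable def goursat (Ψ : ℝ → ℝ → ℂ) (θ w : ℝ) : ℂ :=
  ∫ v in (0 : ℝ)..w, ∫ η in (0 : ℝ)..θ, Ψ η v

theorem hasDerivAt_goursat_snd {Ψ : ℝ → ℝ → ℂ} (hΨ : Continuous ↿Ψ) (θ w : ℝ) :
    HasDerivAt (goursat Ψ θ) (∫ η in (0 : ℝ)..θ, Ψ η w) w :=
  hasDerivAt_integral_of_continuous
    ((continuous_integral_left hΨ).comp (by fun_prop : Continuous fun v => (θ, v))) 0 w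

theorem hasDerivAt_goursat_fst {Ψ : ℝ → ℝ → ℂ} (hΨ : Continuous ↿Ψ) (θ w : ℝ) :
    HasDerivAt (fun θ => goursat Ψ θ w) (∫ v in (0 : ℝ)..w, Ψ θ v) θ :=
  hasDerivAt_intervalIntegral_of_continuous (continuous_integral_left hΨ) hΨ
    (fun θ v => hasDerivAt_integral_of_continuous
      (hΨ.comp (by fun_prop : Continuous fun t => (t, v))) 0 θ) 0 w θ

/-! ### A Gronwall type vanishing principle -/

/-- After n improvements the uniform bound M has become M (Cℓ)ⁿ / n!, which tends to 0. Used with ℓ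
= r for uniqueness of the kernel and with ℓ = w for the Darboux residuals. -/
theorem eq_zero_of_pow_bound_improves {ι : Type*} {s : Set ι} {ℓ : ι → ℝ} {N : ι → ℝ} {C M : ℝ}
    (hN : ∀ i ∈ s, 0 ≤ N i) (hM : ∀ i ∈ s, N i ≤ M)
    (h : ∀ (n : ℕ) (A : ℝ), 0 ≤ A → (∀ i ∈ s, N i ≤ A * ℓ i ^ n) →
      ∀ i ∈ s, N i ≤ C * A * ℓ i ^ (n + 1) / (n + 1)) (hC : 0 ≤ C) : ∀ i ∈ s, N i = 0 := by
  intro i hi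
  have hM0 : 0 ≤ M := (hN i hi).trans (hM i hi)
  have key : ∀ n : ℕ, ∀ i ∈ s, N i ≤ (M * C ^ n / n.factorial) * ℓ i ^ n := by
    intro n
    induction n with
    | zero => simpa using hM
    | succ n ih =>
      intro j hj
      refine (h n _ (by positivity) ih j hj).trans (le_of_eq ?_)
      rw [Nat.factorial_succ]
      push_cast
      field_simp
      ring
  have lim : Tendsto (fun n : ℕ => (M * C ^ n / n.factorial) * ℓ i ^ n) atTop (𝓝 0) := by
    have := (FloorSemiring.tendsto_pow_div_factorial_atTop (C * ℓ i)).const_mul M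
    rw [mul_zero] at this
    refine this.congr fun n => ?_
    rw [mul_pow]; ring
  exact le_antisymm (ge_of_tendsto' lim fun n => key n i hi) (hN i hi)

/-! ### The integral equation for the kernel -/

/-- The right-hand side of the Goursat problem in the characteristic coordinates
`θ = -log a`, `w = r a`. -/
noncomputable def charSource (q : ℝ → ℂ) (K : ℝ → ℝ → ℂ) (η v : ℝ) : ℂ :=
  v * q (v * Real.exp η) * K (v * Real.exp η) (Real.exp (-η))

/-- The function `a² K(r, a)` in characteristic coordinates, as given by the integral equation. -/
noncomputable def charKernel (q : ℝ → ℂ) (K : ℝ → ℝ → ℂ) (θ w : ℝ) : ℂ :=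
  (∫ v in (0 : ℝ)..w, (v : ℂ) * q v) + goursat (charSource q K) θ w

/-- `K` is a continuous solution of the integral equation equivalent to the Goursat problem, in the
variables `r` and `a = √(1 - t)`. -/
structure IsProfile (ρ : ℝ) (q : ℝ → ℂ) (K : ℝ → ℝ → ℂ) : Prop where
  continuous : Continuous ↿K
  bound : ∃ C, 0 ≤ C ∧ ∀ r ∈ Icc 0 ρ, ∀ a ∈ Icc (0 : ℝ) 1, ‖K r a‖ ≤ C * r ^ 2
  eq : ∀ r ∈ Icc 0 ρ, ∀ θ, 0 ≤ θ →
    (Real.exp (-θ) : ℂ) ^ 2 * K r (Real.exp (-θ)) = charKernel q K θ (r * Real.exp (-θ))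

/-- The nearest point projection onto `[0, ρ]`. -/
noncomputable def clamp (ρ x : ℝ) : ℝ := max 0 (min x ρ)

@[fun_prop]
theorem continuous_clamp (ρ : ℝ) : Continuous (clamp ρ) := by
  unfold clamp; fun_prop

theorem clamp_mem {ρ : ℝ} (hρ : 0 ≤ ρ) (x : ℝ) : clamp ρ x ∈ Icc 0 ρ :=
  ⟨le_max_left _ _, max_le hρ (min_le_right _ _)⟩

theorem clamp_of_mem {ρ x : ℝ} (hx : x ∈ Icc 0 ρ) : clamp ρ x = x := by
  rw [clamp, min_eq_left hx.2, max_eq_right hx.1]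

/-! ### Weighted contraction for the integral equation. -/

theorem exists_bound_clamp {ρ : ℝ} (hρ : 0 ≤ ρ) {q : ℝ → ℂ} (hq : ContinuousOn q (Icc 0 ρ)) :
    ∃ Q, 0 ≤ Q ∧ ∀ x, ‖q (clamp ρ x)‖ ≤ Q := by
  obtain ⟨Q, hQ⟩ := isCompact_Icc.exists_bound_of_continuousOn hq
  exact ⟨Q, (norm_nonneg _).trans (hQ 0 ⟨le_rfl, hρ⟩), fun x => hQ _ (clamp_mem hρ x)⟩

theorem continuous_comp_clamp {ρ : ℝ} (hρ : 0 ≤ ρ) {q : ℝ → ℂ} (hq : ContinuousOn q (Icc 0 ρ)) :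
    Continuous fun x => q (clamp ρ x) :=
  hq.comp_continuous (continuous_clamp ρ) (clamp_mem hρ)

/-- The integrand of the inner integral operator of the fixed point equation. -/
noncomputable def innerIntegrand (q : ℝ → ℂ) (l x a : ℝ) (M : ℝ × ℝ → ℂ) (b : ℝ) : ℂ :=
  (Ioi a).indicator
    (fun b => q (x * b) * b * Real.exp (-l * x * (1 - b)) * M (x * b, a / b)) b

/-- The η-integral of the integral equation for K = r² e^{lr} U, after b = a e^η maps [0, -log a] to
[a, 1]. The exponential is the quotient of the weights at xb and x. The cut-off b > a replaces a
variable limit and makes sense for every real a. -/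
noncomputable def innerOp (q : ℝ → ℂ) (l : ℝ) (M : ℝ × ℝ → ℂ) (x a : ℝ) : ℂ :=
  ∫ b in (0 : ℝ)..1, innerIntegrand q l x a M b

theorem norm_innerIntegrand_le {q : ℝ → ℂ} {l x a Q B b : ℝ} {M : ℝ × ℝ → ℂ} (hl : 0 ≤ l)
    (hx : 0 ≤ x) (hq : ∀ x, ‖q x‖ ≤ Q) (hQ : 0 ≤ Q) (hM : ∀ p, ‖M p‖ ≤ B)
    (hb : b ∈ Ioc (0 : ℝ) 1) : ‖innerIntegrand q l x a M b‖ ≤ Q * B := by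
  have hB : 0 ≤ B := (norm_nonneg _).trans (hM (0, 0))
  refine (norm_indicator_le_norm_self _ _).trans ?_
  have h1 : ‖((Real.exp (-l * x * (1 - b)) : ℝ) : ℂ)‖ ≤ 1 := by
    rw [Complex.norm_real, Real.norm_of_nonneg (Real.exp_pos _).le, Real.exp_le_one_iff]
    have := mul_nonneg (mul_nonneg hl hx) (sub_nonneg.2 hb.2)
    linarith
  have h2 : ‖(b : ℂ)‖ ≤ 1 := by
    rw [Complex.norm_real, Real.norm_of_nonneg hb.1.le]; exact hb.2
  rw [norm_mul, norm_mul, norm_mul]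
  calc _ ≤ Q * 1 * 1 * B := by
        gcongr
        · exact hq _
        · exact hM _
    _ = Q * B := by ring

theorem measurable_innerIntegrand {q : ℝ → ℂ} (hq : Continuous q) {M : ℝ × ℝ → ℂ}
    (hM : Continuous M) (l x a : ℝ) : Measurable (innerIntegrand q l x a M) := by
  refine Measurable.indicator ?_ measurableSet_Ioi
  have h1 : Continuous fun b : ℝ => q (x * b) * b * Real.exp (-l * x * (1 - b)) := by fun_prop
  exact h1.measurable.mul (hM.measurable.comp
    ((measurable_id.const_mul x).prodMk (measurable_const.div measurable_id)))

theorem intervalIntegrable_innerIntegrand {q : ℝ → ℂ} {l x a Q B : ℝ} {M : ℝ × ℝ → ℂ} (hl : 0 ≤ l)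
    (hx : 0 ≤ x) (hqc : Continuous q) (hq : ∀ x, ‖q x‖ ≤ Q) (hQ : 0 ≤ Q) (hMc : Continuous M)
    (hM : ∀ p, ‖M p‖ ≤ B) : IntervalIntegrable (innerIntegrand q l x a M) volume 0 1 := by
  rw [intervalIntegrable_iff_integrableOn_Ioc_of_le zero_le_one]
  refine Measure.integrableOn_of_bounded (M := Q * B) (by simp)
    (measurable_innerIntegrand hqc hMc l x a).aestronglyMeasurable ?_
  exact ae_restrict_of_forall_mem measurableSet_Ioc fun b hb =>
    norm_innerIntegrand_le hl hx hq hQ hM hb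

theorem norm_innerOp_le {q : ℝ → ℂ} {l x a Q B : ℝ} {M : ℝ × ℝ → ℂ} (hl : 0 ≤ l)
    (hx : 0 ≤ x) (hq : ∀ x, ‖q x‖ ≤ Q) (hQ : 0 ≤ Q) (hM : ∀ p, ‖M p‖ ≤ B) :
    ‖innerOp q l M x a‖ ≤ Q * B := by
  have := intervalIntegral.norm_integral_le_of_norm_le_const (a := 0) (b := 1)
    (f := innerIntegrand q l x a M) (C := Q * B) (fun b hb => by
      rw [uIoc_of_le zero_le_one] at hb
      exact norm_innerIntegrand_le hl hx hq hQ hM hb)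
  simpa [innerOp] using this

theorem innerOp_sub {q : ℝ → ℂ} {l x a Q B B' : ℝ} {M M' : ℝ × ℝ → ℂ} (hl : 0 ≤ l)
    (hx : 0 ≤ x) (hqc : Continuous q) (hq : ∀ x, ‖q x‖ ≤ Q) (hQ : 0 ≤ Q) (hMc : Continuous M)
    (hM : ∀ p, ‖M p‖ ≤ B) (hMc' : Continuous M') (hM' : ∀ p, ‖M' p‖ ≤ B') :
    innerOp q l M x a - innerOp q l M' x a = innerOp q l (fun p => M p - M' p) x a := by
  rw [innerOp, innerOp, innerOp, ← intervalIntegral.integral_sub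
    (intervalIntegrable_innerIntegrand hl hx hqc hq hQ hMc hM)
    (intervalIntegrable_innerIntegrand hl hx hqc hq hQ hMc' hM')]
  congr 1
  ext b
  by_cases hb : b ∈ Ioi a
  · simp only [innerIntegrand, indicator_of_mem hb]; ring
  · simp only [innerIntegrand, indicator_of_notMem hb, sub_zero]

/-- Dominated convergence with a constant bound. Only boundedness of `M` controls the argument a /
b, so continuity holds at a = 0 as well, that is at t = 1. -/
theorem continuous_innerOp {q : ℝ → ℂ} {l Q B ρ : ℝ} {M : ℝ × ℝ → ℂ} (hl : 0 ≤ l) (hρ : 0 ≤ ρ)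
    (hqc : Continuous q) (hq : ∀ x, ‖q x‖ ≤ Q) (hQ : 0 ≤ Q) (hMc : Continuous M)
    (hM : ∀ p, ‖M p‖ ≤ B) : Continuous fun p : ℝ × ℝ => innerOp q l M (clamp ρ p.1) p.2 := by
  refine continuous_iff_continuousAt.2 fun p => ?_
  refine intervalIntegral.continuousAt_of_dominated_interval (bound := fun _ => Q * B) ?_ ?_ ?_ ?_
  · exact .of_forall fun p => (measurable_innerIntegrand hqc hMc l _ _).aestronglyMeasurable
  · refine .of_forall fun p => .of_forall fun b hb => ?_
    rw [uIoc_of_le zero_le_one] at hb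
    exact norm_innerIntegrand_le hl (clamp_mem hρ _).1 hq hQ hM hb
  · exact intervalIntegrable_const
  -- The cut-off jumps only at b = a, a null set.
  · have : ∀ᵐ b : ℝ, b ≠ p.2 := by simp [ae_iff]
    filter_upwards [this] with b hb _
    have hc : Continuous fun p : ℝ × ℝ => q (clamp ρ p.1 * b) * b *
        Real.exp (-l * clamp ρ p.1 * (1 - b)) * M (clamp ρ p.1 * b, p.2 / b) := by fun_prop
    rcases lt_or_gt_of_ne hb with h | h
    · refine (continuousAt_const (y := (0 : ℂ))).congr ?_
      filter_upwards [continuousAt_snd.eventually (lt_mem_nhds h)] with p' hp'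
      rw [innerIntegrand, indicator_of_notMem (by simpa using hp'.le)]
    · refine hc.continuousAt.congr ?_
      filter_upwards [continuousAt_snd.eventually (gt_mem_nhds h)] with p' hp'
      rw [innerIntegrand, indicator_of_mem (by simpa using hp')]

/-- The w-integral after v = ray. Here v dv gives r²a²y, the factor r² of K at radius ry gives r²y²,
and dividing by a²r²e^{lr} leaves r²y³ and a quotient of weights. -/
noncomputable def outerOp (l : ℝ) (N : ℝ → ℝ → ℂ) (r a : ℝ) : ℂ :=
  ∫ y in (0 : ℝ)..1, (y : ℂ) ^ 3 * r ^ 2 * Real.exp (-l * r * (1 - y)) * N (r * y) a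

/-- One factor r is absorbed by the antiderivative of the exponential and returns 1 / l: this gain
makes the map contracting for large l. -/
theorem integral_sq_mul_exp_le {l r ρ : ℝ} (hl : 0 < l) (hr : 0 ≤ r) (hrρ : r ≤ ρ) :
    ∫ y in (0 : ℝ)..1, r ^ 2 * Real.exp (-l * r * (1 - y)) ≤ ρ / l := by
  have hd : ∀ y ∈ uIcc (0 : ℝ) 1, HasDerivAt (fun y => r / l * Real.exp (-l * r * (1 - y)))
      (r ^ 2 * Real.exp (-l * r * (1 - y))) y := fun y _ => by
    have h1 : HasDerivAt (fun y => -l * r * (1 - y)) (l * r) y := by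
      have := ((hasDerivAt_id y).const_sub 1).const_mul (-l * r)
      simpa using this
    have := h1.exp.const_mul (r / l)
    refine this.congr_deriv ?_
    field_simp
  rw [intervalIntegral.integral_eq_sub_of_hasDerivAt hd
    (Continuous.intervalIntegrable (by fun_prop) _ _)]
  have : 0 ≤ r / l * Real.exp (-l * r * (1 - 0)) := by positivity
  simp only [sub_self, mul_zero, Real.exp_zero, mul_one]
  have : r / l ≤ ρ / l := by gcongr
  linarith

theorem norm_outerOp_le {l r ρ a B : ℝ} {N : ℝ → ℝ → ℂ} (hl : 0 < l) (hr : r ∈ Icc 0 ρ)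
    (hN : ∀ x, ‖N x a‖ ≤ B) : ‖outerOp l N r a‖ ≤ ρ / l * B := by
  have hB : 0 ≤ B := (norm_nonneg _).trans (hN 0)
  have h := intervalIntegral.norm_integral_le_of_norm_le (a := 0) (b := 1) (μ := volume)
    (f := fun y : ℝ => (y : ℂ) ^ 3 * r ^ 2 * Real.exp (-l * r * (1 - y)) * N (r * y) a)
    (g := fun y => r ^ 2 * Real.exp (-l * r * (1 - y)) * B) zero_le_one
    (.of_forall fun y hy => ?_) (Continuous.intervalIntegrable (by fun_prop) _ _)
  · refine h.trans ?_
    rw [intervalIntegral.integral_mul_const]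
    gcongr
    exact integral_sq_mul_exp_le hl hr.1 hr.2
  · have h1 : ‖(y : ℂ)‖ ≤ 1 := by
      rw [Complex.norm_real, Real.norm_of_nonneg hy.1.le]; exact hy.2
    have h2 : ‖((Real.exp (-l * r * (1 - y)) : ℝ) : ℂ)‖ = Real.exp (-l * r * (1 - y)) := by
      rw [Complex.norm_real, Real.norm_of_nonneg (Real.exp_pos _).le]
    have h3 : ‖(r : ℂ) ^ 2‖ = r ^ 2 := by
      rw [norm_pow, Complex.norm_real, Real.norm_of_nonneg hr.1]
    rw [norm_mul, norm_mul, norm_mul, h2, h3, norm_pow]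
    calc _ ≤ 1 ^ 3 * r ^ 2 * Real.exp (-l * r * (1 - y)) * B := by
          gcongr
          exact hN _
      _ = _ := by ring

theorem outerOp_sub {l r a : ℝ} {N N' : ℝ → ℝ → ℂ} (hN : Continuous ↿N) (hN' : Continuous ↿N') :
    outerOp l N r a - outerOp l N' r a = outerOp l (fun x a => N x a - N' x a) r a := by
  have h : ∀ {N : ℝ → ℝ → ℂ}, Continuous ↿N → Continuous fun y => N (r * y) a := fun h =>
    h.comp (by fun_prop : Continuous fun y => (r * y, a))
  have h1 := h hN
  have h2 := h hN'
  rw [outerOp, outerOp, outerOp, ← intervalIntegral.integral_sub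
    (Continuous.intervalIntegrable (by fun_prop) _ _)
    (Continuous.intervalIntegrable (by fun_prop) _ _)]
  congr 1
  ext y
  ring

theorem continuous_outerOp {l ρ : ℝ} {N : ℝ → ℝ → ℂ} (hN : Continuous ↿N) :
    Continuous fun p : ℝ × ℝ => outerOp l N (clamp ρ p.1) p.2 := by
  refine intervalIntegral.continuous_parametric_intervalIntegral_of_continuous' (f :=
    fun (p : ℝ × ℝ) (y : ℝ) => (y : ℂ) ^ 3 * (clamp ρ p.1 : ℂ) ^ 2 *
      Real.exp (-l * clamp ρ p.1 * (1 - y)) * N (clamp ρ p.1 * y) p.2) ?_ 0 1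
  have : Continuous fun z : (ℝ × ℝ) × ℝ => N (clamp ρ z.1.1 * z.2) z.1.2 :=
    hN.comp (by fun_prop : Continuous fun z : (ℝ × ℝ) × ℝ => (clamp ρ z.1.1 * z.2, z.1.2))
  simp only [uncurry_def]
  fun_prop

/-- The datum ∫_0^{ra} v q(v) dv divided by a²r²e^{lr}, in a form that makes sense at ra = 0. -/
noncomputable def sourceTerm (q : ℝ → ℂ) (l r a : ℝ) : ℂ :=
  Real.exp (-l * r) * ∫ y in (0 : ℝ)..1, (y : ℂ) * q (r * y * a)

theorem continuous_sourceTerm {q : ℝ → ℂ} (hq : Continuous q) (l ρ : ℝ) :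
    Continuous fun p : ℝ × ℝ => sourceTerm q l (clamp ρ p.1) p.2 := by
  unfold sourceTerm
  have : Continuous fun p : ℝ × ℝ => ∫ y in (0 : ℝ)..1, (y : ℂ) * q (clamp ρ p.1 * y * p.2) := by
    refine intervalIntegral.continuous_parametric_intervalIntegral_of_continuous' (f :=
      fun (p : ℝ × ℝ) (y : ℝ) => (y : ℂ) * q (clamp ρ p.1 * y * p.2)) ?_ 0 1
    simp only [uncurry_def]
    fun_prop
  fun_prop

theorem norm_sourceTerm_le {q : ℝ → ℂ} {l r a Q : ℝ} (hl : 0 ≤ l) (hr : 0 ≤ r)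
    (hq : ∀ x, ‖q x‖ ≤ Q) : ‖sourceTerm q l r a‖ ≤ Q := by
  have hQ : 0 ≤ Q := (norm_nonneg _).trans (hq 0)
  have h1 : ‖((Real.exp (-l * r) : ℝ) : ℂ)‖ ≤ 1 := by
    rw [Complex.norm_real, Real.norm_of_nonneg (Real.exp_pos _).le, Real.exp_le_one_iff]
    nlinarith [mul_nonneg hl hr]
  have h2 := intervalIntegral.norm_integral_le_of_norm_le_const (a := 0) (b := 1)
    (f := fun y : ℝ => (y : ℂ) * q (r * y * a)) (C := Q) (fun y hy => by
      rw [uIoc_of_le zero_le_one] at hy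
      rw [norm_mul, Complex.norm_real, Real.norm_of_nonneg hy.1.le]
      calc y * ‖q (r * y * a)‖ ≤ 1 * Q := by
            gcongr
            · exact hy.2
            · exact hq _
        _ = Q := one_mul Q)
  rw [sourceTerm, norm_mul]
  calc _ ≤ 1 * (Q * |1 - 0|) := by gcongr
    _ = Q := by simp

theorem exists_fixedPoint {ρ : ℝ} (hρ : 0 ≤ ρ) {q : ℝ → ℂ} (hqc : Continuous q) {Q : ℝ}
    (hQ : 0 ≤ Q) (hq : ∀ x, ‖q x‖ ≤ Q) : ∃ l : ℝ, 0 ≤ l ∧ ∃ U : ℝ × ℝ →ᵇ ℂ, ∀ r ∈ Icc 0 ρ, ∀ a,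
      U (r, a) = sourceTerm q l r a +
        outerOp l (fun x a => innerOp q l U (clamp ρ x) a) r a := by
  -- The Lipschitz constant is at most (ρ / l) Q, hence at most 1/2; the summand 1 keeps l positive
  -- when Q = 0 or ρ = 0.
  set l : ℝ := 2 * (ρ * Q) + 1 with hl_def
  have hl : 0 < l := by positivity
  have bd : ∀ (M : ℝ × ℝ →ᵇ ℂ) (x a : ℝ), ‖innerOp q l M (clamp ρ x) a‖ ≤ Q * ‖M‖ := fun M x a =>
    norm_innerOp_le hl.le (clamp_mem hρ x).1 hq hQ M.norm_coe_le_norm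
  have cont : ∀ M : ℝ × ℝ →ᵇ ℂ, Continuous ↿(fun x a => innerOp q l M (clamp ρ x) a) := fun M =>
    continuous_innerOp hl.le hρ hqc hq hQ M.continuous M.norm_coe_le_norm
  -- Clamping the radius gives bounded functions on the whole plane; the equation itself is
  -- recovered only for r in [0, ρ].
  let T : (ℝ × ℝ →ᵇ ℂ) → (ℝ × ℝ →ᵇ ℂ) := fun M => ofNormedAddCommGroup
    (fun p => sourceTerm q l (clamp ρ p.1) p.2 +
      outerOp l (fun x a => innerOp q l M (clamp ρ x) a) (clamp ρ p.1) p.2)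
    ((continuous_sourceTerm hqc l ρ).add (continuous_outerOp (cont M)))
    (Q + ρ / l * (Q * ‖M‖))
    (fun p => (norm_add_le _ _).trans (add_le_add
      (norm_sourceTerm_le hl.le (clamp_mem hρ _).1 hq)
      (norm_outerOp_le hl (clamp_mem hρ _) fun x => bd M x _)))
  have hT : ContractingWith (1 / 2) T := by
    refine ⟨by rw [← NNReal.coe_lt_coe]; norm_num, LipschitzWith.of_dist_le_mul fun M M' => ?_⟩
    rw [dist_le (by positivity)]
    intro p
    simp only [T, coe_ofNormedAddCommGroup]
    rw [dist_add_left, dist_eq_norm, outerOp_sub (cont M) (cont M')]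
    have h1 : ∀ x, ‖innerOp q l M (clamp ρ x) p.2 - innerOp q l M' (clamp ρ x) p.2‖ ≤
        Q * dist M M' := fun x => by
      rw [innerOp_sub hl.le (clamp_mem hρ x).1 hqc hq hQ M.continuous M.norm_coe_le_norm
        M'.continuous M'.norm_coe_le_norm]
      refine norm_innerOp_le hl.le (clamp_mem hρ x).1 hq hQ fun p => ?_
      rw [← dist_eq_norm]
      exact dist_coe_le_dist p
    refine (norm_outerOp_le hl (clamp_mem hρ _) h1).trans ?_
    have h2 : ρ / l * Q ≤ 1 / 2 := by
      rw [div_mul_eq_mul_div, div_le_iff₀ hl]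
      rw [hl_def]; linarith
    calc ρ / l * (Q * dist M M') = ρ / l * Q * dist M M' := by ring
      _ ≤ 1 / 2 * dist M M' := by gcongr
      _ = _ := by simp
  refine ⟨l, hl.le, hT.fixedPoint, fun r hr a => ?_⟩
  have h := congrArg (fun M : ℝ × ℝ →ᵇ ℂ => M (r, a)) hT.fixedPoint_isFixedPt
  simp only [T, coe_ofNormedAddCommGroup, clamp_of_mem hr] at h
  exact h.symm

theorem innerOp_eq {q : ℝ → ℂ} {l x θ : ℝ} {U : ℝ × ℝ → ℂ} (hq : Continuous q)
    (hU : Continuous U) (hθ : 0 ≤ θ) :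
    (x : ℂ) ^ 2 * Real.exp (l * x) * innerOp q l U x (Real.exp (-θ)) =
      ∫ η in (0 : ℝ)..θ, q (x * Real.exp (-θ) * Real.exp η) *
        ((x * Real.exp (-θ) * Real.exp η : ℝ) ^ 2 *
          Real.exp (l * (x * Real.exp (-θ) * Real.exp η)) *
          U (x * Real.exp (-θ) * Real.exp η, Real.exp (-η))) := by
  set a := Real.exp (-θ) with ha
  have ha0 : 0 < a := Real.exp_pos _
  have ha1 : a ≤ 1 := Real.exp_le_one_iff.2 (by linarith)
  let g : ℝ → ℂ := fun b => q (x * b) * b * Real.exp (-l * x * (1 - b)) * U (x * b, a / b)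
  have h1 : innerOp q l U x a = ∫ b in a..1, g b := by
    rw [innerOp, intervalIntegral.integral_of_le zero_le_one, intervalIntegral.integral_of_le ha1]
    change ∫ b in Ioc 0 1, (Ioi a).indicator g b = _
    rw [setIntegral_indicator measurableSet_Ioi]
    congr 2
    ext b
    simp only [mem_inter_iff, mem_Ioc, mem_Ioi]
    exact ⟨fun h => ⟨h.2, h.1.2⟩, fun h => ⟨⟨ha0.trans h.1, h.2⟩, h.1⟩⟩
  have hd : ∀ η ∈ uIcc 0 θ, HasDerivAt (fun η => a * Real.exp η) (a * Real.exp η) η :=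
    fun η _ => (Real.hasDerivAt_exp η).const_mul a
  have hgc : ContinuousOn g ((fun η => a * Real.exp η) '' uIcc 0 θ) := by
    have : ∀ b ∈ (fun η => a * Real.exp η) '' uIcc 0 θ, b ≠ 0 := by
      rintro _ ⟨η, -, rfl⟩
      positivity
    refine ContinuousOn.mul (Continuous.continuousOn (by fun_prop)) ?_
    exact hU.comp_continuousOn ((by fun_prop : Continuous fun b : ℝ => x * b).continuousOn.prodMk
      (continuousOn_const.div continuousOn_id this))
  -- Substitution b = a e^η, where a e^θ = 1.
  have h2 := intervalIntegral.integral_deriv_smul_comp' (a := 0) (b := θ) (g := g) hd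
    (Continuous.continuousOn (by fun_prop)) hgc
  have h3 : a * Real.exp θ = 1 := by rw [ha, ← Real.exp_add]; simp
  rw [Real.exp_zero, mul_one, h3] at h2
  rw [h1, ← h2, ← intervalIntegral.integral_const_mul]
  congr 1
  ext η
  have h4 : a / (a * Real.exp η) = Real.exp (-η) := by
    rw [Real.exp_neg]; field_simp
  have h5 : Real.exp (l * (x * a * Real.exp η)) =
      Real.exp (l * x) * Real.exp (-l * x * (1 - a * Real.exp η)) := by
    rw [← Real.exp_add]; congr 1; ring
  have h6 : x * (a * Real.exp η) = x * a * Real.exp η := by ring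
  simp only [g, comp_apply, h4, h5, h6, Complex.real_smul, Complex.ofReal_mul]
  ring

theorem charKernel_eq_integral {q : ℝ → ℂ} {K : ℝ → ℝ → ℂ} (hq : Continuous q)
    (hK : Continuous ↿K) (θ w : ℝ) : charKernel q K θ w = ∫ v in (0 : ℝ)..w, (v : ℂ) *
      (q v + ∫ η in (0 : ℝ)..θ, q (v * Real.exp η) * K (v * Real.exp η) (Real.exp (-η))) := by
  have hc : Continuous fun z : ℝ × ℝ => K (z.1 * Real.exp z.2) (Real.exp (-z.2)) :=
    hK.comp (by fun_prop : Continuous fun z : ℝ × ℝ => (z.1 * Real.exp z.2, Real.exp (-z.2)))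
  have hFc : Continuous fun v : ℝ => ∫ η in (0 : ℝ)..θ,
      q (v * Real.exp η) * K (v * Real.exp η) (Real.exp (-η)) := by
    refine intervalIntegral.continuous_parametric_intervalIntegral_of_continuous'
      (f := fun v η => q (v * Real.exp η) * K (v * Real.exp η) (Real.exp (-η))) ?_ 0 θ
    simp only [uncurry_def]
    fun_prop
  rw [charKernel, goursat, ← intervalIntegral.integral_add
    (Continuous.intervalIntegrable (by fun_prop) _ _)]
  · congr 1
    ext v
    simp only [charSource, mul_add, mul_assoc, intervalIntegral.integral_const_mul]
  · simp only [charSource, mul_assoc, intervalIntegral.integral_const_mul]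
    exact Continuous.intervalIntegrable (by fun_prop) _ _

theorem exists_isProfile {ρ : ℝ} (hρ : 0 ≤ ρ) {q : ℝ → ℂ} (hq : Continuous q) :
    ∃ K, IsProfile ρ q K := by
  obtain ⟨Q, hQ, hqQ⟩ := exists_bound_clamp hρ hq.continuousOn
  have hcc := continuous_comp_clamp hρ hq.continuousOn
  obtain ⟨l, hl, U, hU⟩ := exists_fixedPoint hρ hcc hQ hqQ
  set p : ℝ → ℂ := fun x => q (clamp ρ x) with hp
  have hpq : ∀ x ∈ Icc 0 ρ, p x = q x := fun x hx => by simp only [hp, clamp_of_mem hx]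
  -- Undoing the weight; the factor r² provides the quadratic bound required of a profile.
  set K : ℝ → ℝ → ℂ := fun r a => (r : ℂ) ^ 2 * Real.exp (l * r) * U (r, a) with hK
  have hKc : Continuous ↿K := by
    change Continuous fun z : ℝ × ℝ => (z.1 : ℂ) ^ 2 * Real.exp (l * z.1) * U (z.1, z.2)
    fun_prop
  refine ⟨K, hKc, ⟨Real.exp (|l| * ρ) * ‖U‖, by positivity, ?_⟩, ?_⟩
  · intro r hr a _
    rw [hK, norm_mul, norm_mul, norm_pow, Complex.norm_real, Complex.norm_real,
      Real.norm_of_nonneg hr.1, Real.norm_of_nonneg (Real.exp_pos _).le]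
    have h1 : Real.exp (l * r) ≤ Real.exp (|l| * ρ) := by
      refine Real.exp_le_exp.2 ((mul_le_mul_of_nonneg_right (le_abs_self l) hr.1).trans ?_)
      exact mul_le_mul_of_nonneg_left hr.2 (abs_nonneg l)
    calc _ ≤ r ^ 2 * Real.exp (|l| * ρ) * ‖U‖ := by
          gcongr
          exact U.norm_coe_le_norm _
      _ = _ := by ring
  · intro r hr θ hθ
    set a := Real.exp (-θ) with ha
    have ha0 : 0 < a := Real.exp_pos _
    have ha1 : a ≤ 1 := Real.exp_le_one_iff.2 (by linarith)
    let F : ℝ → ℂ := fun v => q v +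
      ∫ η in (0 : ℝ)..θ, q (v * Real.exp η) * K (v * Real.exp η) (Real.exp (-η))
    have hch : charKernel q K θ (r * a) = ∫ v in (0 : ℝ)..(r * a), (v : ℂ) * F v :=
      charKernel_eq_integral hq hKc θ _
    have hsub : ∫ v in (0 : ℝ)..(r * a), (v : ℂ) * F v =
        (r * a : ℝ) * ∫ y in (0 : ℝ)..1, ((r * a * y : ℝ) : ℂ) * F (r * a * y) := by
      have := intervalIntegral.smul_integral_comp_mul_left (a := 0) (b := 1)
        (fun v : ℝ => (v : ℂ) * F v) (r * a)
      simp only [mul_zero, mul_one, Complex.real_smul] at this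
      exact this.symm
    have hFy : ∀ y ∈ Icc (0 : ℝ) 1, F (r * a * y) = p (r * y * a) +
        ((r * y : ℝ) : ℂ) ^ 2 * Real.exp (l * (r * y)) *
          innerOp p l U (clamp ρ (r * y)) a := by
      intro y hy
      have hry : r * y ∈ Icc 0 ρ := ⟨mul_nonneg hr.1 hy.1,
        (mul_le_of_le_one_right hr.1 hy.2).trans hr.2⟩
      rw [clamp_of_mem hry, innerOp_eq hcc U.continuous hθ, hpq _
        ⟨mul_nonneg hry.1 ha0.le, (mul_le_of_le_one_right hry.1 ha1).trans hry.2⟩]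
      have e : r * a * y = r * y * a := by ring
      simp only [F, e]
      congr 1
      refine intervalIntegral.integral_congr fun η hη => ?_
      rw [uIcc_of_le hθ] at hη
      have : a * Real.exp η ≤ 1 := by
        rw [ha, ← Real.exp_add]; exact Real.exp_le_one_iff.2 (by linarith [hη.2])
      have hm : r * y * a * Real.exp η ∈ Icc 0 ρ := by
        refine ⟨by have := hry.1; positivity, ?_⟩
        rw [mul_assoc]
        exact (mul_le_of_le_one_right hry.1 this).trans hry.2
      simp only [hK, ← ha, hpq _ hm]
    have hint : ∫ y in (0 : ℝ)..1, ((r * a * y : ℝ) : ℂ) * F (r * a * y) =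
        (r * a : ℝ) * (Real.exp (l * r) * U (r, a)) := by
      have hi : Continuous fun y : ℝ => innerOp p l U (clamp ρ (r * y)) a :=
        (continuous_innerOp hl hρ hcc hqQ hQ U.continuous U.norm_coe_le_norm).comp
          (by fun_prop : Continuous fun y : ℝ => (r * y, a))
      have e1 : ∀ y, Real.exp (l * r) * Real.exp (-l * r * (1 - y)) = Real.exp (l * (r * y)) :=
        fun y => by rw [← Real.exp_add]; congr 1; ring
      have e2 : Real.exp (l * r) * Real.exp (-l * r) = 1 := by rw [← Real.exp_add]; simp
      rw [hU r hr a, sourceTerm, outerOp, mul_add, ← mul_assoc, ← Complex.ofReal_mul, e2,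
        Complex.ofReal_one, one_mul, ← intervalIntegral.integral_const_mul,
        ← intervalIntegral.integral_add, ← intervalIntegral.integral_const_mul]
      · refine intervalIntegral.integral_congr fun y hy => ?_
        rw [uIcc_of_le zero_le_one] at hy
        simp only [hFy y hy, ← e1]
        push_cast
        ring
      · exact Continuous.intervalIntegrable (by fun_prop) _ _
      · exact Continuous.intervalIntegrable (by fun_prop) _ _
    rw [hch, hsub, hint]
    simp only [hK]
    push_cast
    ring

/-! ### Regularity of the kernel in characteristic coordinates -/

theorem continuous_charSource {q : ℝ → ℂ} {K : ℝ → ℝ → ℂ} (hq : Continuous q)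
    (hK : Continuous ↿K) : Continuous ↿(charSource q K) := by
  have hc : Continuous fun z : ℝ × ℝ => K (z.2 * Real.exp z.1) (Real.exp (-z.1)) :=
    hK.comp (by fun_prop : Continuous fun z : ℝ × ℝ => (z.2 * Real.exp z.1, Real.exp (-z.1)))
  change Continuous fun z : ℝ × ℝ => (z.2 : ℂ) * q (z.2 * Real.exp z.1) *
    K (z.2 * Real.exp z.1) (Real.exp (-z.1))
  fun_prop

/-- The solution of the characteristic Goursat problem with source `S`. -/
noncomputable def charSolution (q : ℝ → ℂ) (S : ℝ → ℝ → ℂ) (θ w : ℝ) : ℂ :=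
  (∫ v in (0 : ℝ)..w, (v : ℂ) * q v) + goursat S θ w

noncomputable def charSolutionDeriv (q : ℝ → ℂ) (S : ℝ → ℝ → ℂ) (θ w : ℝ) : ℂ :=
  w * q w + ∫ η in (0 : ℝ)..θ, S η w

theorem hasDerivAt_charSolution_snd {q : ℝ → ℂ} {S : ℝ → ℝ → ℂ} (hq : Continuous q)
    (hS : Continuous ↿S) (θ w : ℝ) :
    HasDerivAt (charSolution q S θ) (charSolutionDeriv q S θ w) w :=
  (hasDerivAt_integral_of_continuous (g := fun v => (v : ℂ) * q v) (by fun_prop) 0 w).add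
    (hasDerivAt_goursat_snd hS θ w)

theorem hasDerivAt_charSolution_fst {q : ℝ → ℂ} {S : ℝ → ℝ → ℂ}
    (hS : Continuous ↿S) (θ w : ℝ) :
    HasDerivAt (fun θ => charSolution q S θ w) (∫ v in (0 : ℝ)..w, S θ v) θ :=
  (hasDerivAt_goursat_fst hS θ w).const_add _

theorem hasDerivAt_charSolutionDeriv_fst {q : ℝ → ℂ} {S : ℝ → ℝ → ℂ} (hS : Continuous ↿S)
    (θ w : ℝ) : HasDerivAt (fun θ => charSolutionDeriv q S θ w) (S θ w) θ :=
  (hasDerivAt_integral_of_continuous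
    (hS.comp (by fun_prop : Continuous fun t => (t, w))) 0 θ).const_add _

theorem contDiff_one_charSolution {q : ℝ → ℂ} {S : ℝ → ℝ → ℂ} (hq : Continuous q)
    (hS : Continuous ↿S) : ContDiff ℝ 1 ↿(charSolution q S) := by
  refine contDiff_succ_of_partials (n := 0) (hasDerivAt_charSolution_fst hS)
    (hasDerivAt_charSolution_snd hq hS) (contDiff_zero.2 (continuous_integral_right hS))
    (contDiff_zero.2 ?_)
  exact (by fun_prop : Continuous fun z : ℝ × ℝ => (z.2 : ℂ) * q z.2).add
    (continuous_integral_left hS)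

theorem contDiff_one_charSolutionDeriv {q : ℝ → ℂ} {S : ℝ → ℝ → ℂ} (hq : ContDiff ℝ 1 q)
    (hS : ContDiff ℝ 1 ↿S) : ContDiff ℝ 1 ↿(charSolutionDeriv q S) := by
  have h : ContDiff ℝ 1 fun z : ℝ × ℝ => (z.2 : ℂ) * q z.2 :=
    (Complex.ofRealCLM.contDiff.comp contDiff_snd).mul (hq.comp contDiff_snd)
  exact h.add (contDiff_one_integral_left hS)

theorem contDiff_two_charSolution {q : ℝ → ℂ} {S : ℝ → ℝ → ℂ} (hq : ContDiff ℝ 1 q)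
    (hS : ContDiff ℝ 1 ↿S) : ContDiff ℝ 2 ↿(charSolution q S) := by
  have h := contDiff_succ_of_partials (n := 1) (hasDerivAt_charSolution_fst hS.continuous)
    (hasDerivAt_charSolution_snd hq.continuous hS.continuous) (contDiff_one_integral_right hS)
    (contDiff_one_charSolutionDeriv hq hS)
  simpa [one_add_one_eq_two] using h

/-- The right-hand side of the Goursat problem expressed through the unknown itself. -/
noncomputable def smoothSource (q : ℝ → ℂ) (K : ℝ → ℝ → ℂ) (η v : ℝ) : ℂ :=
  v * q (v * Real.exp η) * Real.exp η ^ 2 * charKernel q K η v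

theorem contDiff_one_smoothSource {q : ℝ → ℂ} {K : ℝ → ℝ → ℂ} (hq : ContDiff ℝ 1 q)
    (hK : Continuous ↿K) : ContDiff ℝ 1 ↿(smoothSource q K) := by
  have h1 : ContDiff ℝ 1 ↿(charKernel q K) :=
    contDiff_one_charSolution hq.continuous (continuous_charSource hq.continuous hK)
  have h2 : ContDiff ℝ 1 fun z : ℝ × ℝ => q (z.2 * Real.exp z.1) :=
    hq.comp (contDiff_snd.mul (Real.contDiff_exp.comp contDiff_fst))
  have h3 : ContDiff ℝ 1 fun z : ℝ × ℝ => (Real.exp z.1 : ℂ) ^ 2 :=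
    (Complex.ofRealCLM.contDiff.comp (Real.contDiff_exp.comp contDiff_fst)).pow 2
  have h4 : ContDiff ℝ 1 fun z : ℝ × ℝ => (z.2 : ℂ) := Complex.ofRealCLM.contDiff.comp contDiff_snd
  exact ((h4.mul h2).mul h3).mul h1

theorem IsProfile.charKernel_eq {ρ : ℝ} {q : ℝ → ℂ} {K : ℝ → ℝ → ℂ} (h : IsProfile ρ q K)
    {η v : ℝ} (hη : 0 ≤ η) (hv : v * Real.exp η ∈ Icc 0 ρ) :
    charKernel q K η v = (Real.exp (-η) : ℂ) ^ 2 * K (v * Real.exp η) (Real.exp (-η)) := by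
  rw [h.eq _ hv _ hη, mul_assoc, ← Real.exp_add]; simp

theorem IsProfile.charSource_eq {ρ : ℝ} {q : ℝ → ℂ} {K : ℝ → ℝ → ℂ} (h : IsProfile ρ q K)
    {η v : ℝ} (hη : 0 ≤ η) (hv : v * Real.exp η ∈ Icc 0 ρ) :
    charSource q K η v = smoothSource q K η v := by
  have : (Real.exp η : ℂ) ^ 2 * (Real.exp (-η) : ℂ) ^ 2 = 1 := by
    rw [← mul_pow, ← Complex.ofReal_mul, ← Real.exp_add]; simp
  rw [smoothSource, h.charKernel_eq hη hv, charSource]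
  linear_combination -(v * q (v * Real.exp η) * K (v * Real.exp η) (Real.exp (-η))) * this

/-- The bootstrap. On the rectangle of integration v e^η ≤ w e^θ ≤ ρ, so the integral equation
itself rewrites the merely continuous source as one that is C¹ when q is C¹, since `charKernel` is
already C¹. -/
theorem IsProfile.charKernel_eq_charSolution {ρ : ℝ} {q : ℝ → ℂ} {K : ℝ → ℝ → ℂ}
    (h : IsProfile ρ q K) {θ w : ℝ} (hθ : 0 ≤ θ) (hw : w * Real.exp θ ∈ Icc 0 ρ) :
    charKernel q K θ w = charSolution q (smoothSource q K) θ w := by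
  have hw0 : 0 ≤ w := by
    by_contra hc
    exact absurd hw.1 (not_le.2 (mul_neg_of_neg_of_pos (not_le.1 hc) (Real.exp_pos _)))
  rw [charKernel, charSolution]
  congr 1
  refine intervalIntegral.integral_congr fun v hv => ?_
  refine intervalIntegral.integral_congr fun η hη => ?_
  rw [uIcc_of_le hw0] at hv
  rw [uIcc_of_le hθ] at hη
  refine h.charSource_eq hη.1 ⟨mul_nonneg hv.1 (Real.exp_pos _).le, le_trans ?_ hw.2⟩
  exact mul_le_mul hv.2 (Real.exp_le_exp.2 hη.2) (Real.exp_pos _).le hw0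

theorem IsProfile.eq_charSolution {ρ : ℝ} {q : ℝ → ℂ} {K : ℝ → ℝ → ℂ}
    (h : IsProfile ρ q K) {r a : ℝ} (hr : r ∈ Icc 0 ρ) (ha : a ∈ Ioc (0 : ℝ) 1) :
    K r a = charSolution q (smoothSource q K) (-Real.log a) (r * a) / (a : ℂ) ^ 2 := by
  have ha' : (a : ℂ) ≠ 0 := Complex.ofReal_ne_zero.2 ha.1.ne'
  have hl : 0 ≤ -Real.log a := neg_nonneg.2 (Real.log_nonpos ha.1.le ha.2)
  have he : Real.exp (- -Real.log a) = a := by rw [neg_neg, Real.exp_log ha.1]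
  have hm : r * a * Real.exp (-Real.log a) = r := by
    rw [Real.exp_neg, Real.exp_log ha.1, mul_assoc, mul_inv_cancel₀ ha.1.ne', mul_one]
  have h1 := h.eq r hr _ hl
  rw [he] at h1
  rw [← h.charKernel_eq_charSolution hl (by rwa [hm]), ← h1]
  field_simp

/-! ### From characteristic coordinates back to the Goursat problem. -/

theorem hasDerivAt_sqrt_one_sub {t : ℝ} (ht : t < 1) :
    HasDerivAt (fun s => √(1 - s)) (-(1 / (2 * √(1 - t)))) t := by
  have h := ((hasDerivAt_id t).const_sub 1).sqrt (by simp only [id]; linarith)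
  simpa [neg_div] using h

/-- With P = J_w one has G_r = P / a, so the second derivatives in the equation are first
derivatives of P. In r G_rr - G_r + 2(1 - t) G_rt the terms in P and P_w cancel, leaving P_θ / a = S
/ a = r q K. -/
theorem IsProfile.isTransmutationKernel {ρ : ℝ} (hρ : 0 ≤ ρ) {q : ℝ → ℂ} {K : ℝ → ℝ → ℂ}
    (hq : ContDiff ℝ 1 q) (h : IsProfile ρ q K) :
    IsTransmutationKernel ρ q fun r t => K r (√(1 - t)) := by
  set S := smoothSource q K with hS_def
  have hS : ContDiff ℝ 1 ↿S := contDiff_one_smoothSource hq h.continuous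
  set P := charSolutionDeriv q S with hP_def
  have hP : ContDiff ℝ 1 ↿P := contDiff_one_charSolutionDeriv hq hS
  have hsq : ∀ t ∈ Ioo (0 : ℝ) 1, √(1 - t) ∈ Ioc (0 : ℝ) 1 := fun t ht =>
    ⟨Real.sqrt_pos.2 (by linarith [ht.2]), Real.sqrt_le_one.2 (by linarith [ht.1])⟩
  have hr_deriv : ∀ r ∈ Ioo 0 ρ, ∀ t ∈ Ioo (0 : ℝ) 1, deriv (fun x => K x (√(1 - t))) r =
      P (-Real.log (√(1 - t))) (r * √(1 - t)) / (√(1 - t) : ℂ) := by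
    intro r hr t ht
    have ha := hsq t ht
    set a := √(1 - t)
    have ha' : (a : ℂ) ≠ 0 := Complex.ofReal_ne_zero.2 ha.1.ne'
    have h1 : HasDerivAt (fun x : ℝ => charSolution q S (-Real.log a) (x * a) / (a : ℂ) ^ 2)
        (a • P (-Real.log a) (r * a) / (a : ℂ) ^ 2) r := by
      refine HasDerivAt.div_const (HasDerivAt.scomp r (g₁ := charSolution q S (-Real.log a))
        (h := fun x => x * a)
        (hasDerivAt_charSolution_snd hq.continuous hS.continuous _ _) ?_) _
      simpa using (hasDerivAt_id r).mul_const a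
    have h2 : (fun x => K x a) =ᶠ[𝓝 r]
        fun x : ℝ => charSolution q S (-Real.log a) (x * a) / (a : ℂ) ^ 2 := by
      filter_upwards [Ioo_mem_nhds hr.1 hr.2] with x hx
      exact h.eq_charSolution (Ioo_subset_Icc_self hx) ha
    rw [h2.deriv_eq, h1.deriv, Complex.real_smul]
    field_simp
  refine ⟨?_, ?_, ?_, ?_, ?_⟩
  · exact (h.continuous.comp
      (by fun_prop : Continuous fun p : ℝ × ℝ => (p.1, √(1 - p.2)))).continuousOn
  · have hcs : ContDiff ℝ 2 ↿(charSolution q S) := contDiff_two_charSolution hq hS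
    have hne : ∀ p ∈ Ioo 0 ρ ×ˢ Ioo (0 : ℝ) 1, (1 : ℝ) - p.2 ≠ 0 := fun p hp => by
      linarith [hp.2.2]
    have hs : ContDiffOn ℝ 2 (fun p : ℝ × ℝ => √(1 - p.2)) (Ioo 0 ρ ×ˢ Ioo (0 : ℝ) 1) :=
      (contDiff_const.sub contDiff_snd).contDiffOn.sqrt hne
    have hs0 : ∀ p ∈ Ioo 0 ρ ×ˢ Ioo (0 : ℝ) 1, √(1 - p.2) ≠ 0 := fun p hp =>
      (hsq p.2 hp.2).1.ne'
    have hE : ContDiffOn ℝ 2 (fun p : ℝ × ℝ =>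
        charSolution q S (-Real.log (√(1 - p.2))) (p.1 * √(1 - p.2)) / (√(1 - p.2) : ℂ) ^ 2)
        (Ioo 0 ρ ×ˢ Ioo (0 : ℝ) 1) := by
      simp only [div_eq_mul_inv]
      refine ContDiffOn.mul (hcs.comp_contDiffOn (f := fun p : ℝ × ℝ =>
        (-Real.log (√(1 - p.2)), p.1 * √(1 - p.2))) ((hs.log hs0).neg.prodMk
          (contDiff_fst.contDiffOn.mul hs)))
          (((Complex.ofRealCLM.contDiff.comp_contDiffOn hs).pow 2).inv
          fun p hp => pow_ne_zero _ (Complex.ofReal_ne_zero.2 (hs0 p hp)))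
    refine hE.congr fun p hp => ?_
    exact h.eq_charSolution (Ioo_subset_Icc_self hp.1) (hsq p.2 hp.2)
  · intro r hr t ht
    have ha := hsq t ht
    have hsd := hasDerivAt_sqrt_one_sub ht.2
    have hsq2 : √(1 - t) ^ 2 = 1 - t := Real.sq_sqrt (by linarith [ht.2])
    have e1 : (fun x => deriv (fun y => K y (√(1 - t))) x) =ᶠ[𝓝 r]
        fun x : ℝ => P (-Real.log (√(1 - t))) (x * √(1 - t)) / (√(1 - t) : ℂ) := by
      filter_upwards [Ioo_mem_nhds hr.1 hr.2] with x hx using hr_deriv x hx t ht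
    have e2 : (fun s => deriv (fun x => K x (√(1 - s))) r) =ᶠ[𝓝 t]
        fun s : ℝ => P (-Real.log (√(1 - s))) (r * √(1 - s)) / (√(1 - s) : ℂ) := by
      filter_upwards [Ioo_mem_nhds ht.1 ht.2] with s hs using hr_deriv r hr s hs
    have hK := h.eq_charSolution (Ioo_subset_Icc_self hr) ha
    rw [e1.deriv_eq, e2.deriv_eq, hr_deriv r hr t ht]
    set a := √(1 - t) with ha_def
    set θ := -Real.log a with hθ_def
    have ha' : (a : ℂ) ≠ 0 := Complex.ofReal_ne_zero.2 ha.1.ne'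
    have hPd := (hP.differentiable one_ne_zero (θ, r * a)).hasFDerivAt
    set D := fderiv ℝ ↿P (θ, r * a) with hD
    have hD1 : D (1, 0) = S θ (r * a) := by
      have h1 := hPd.comp_hasDerivAt θ (f := fun x => (x, r * a))
        ((hasDerivAt_id θ).prodMk (hasDerivAt_const θ (r * a)))
      exact h1.unique (hasDerivAt_charSolutionDeriv_fst hS.continuous θ (r * a))
    have hDlin : ∀ x y : ℝ, D (x, y) = x * D (1, 0) + y * D (0, 1) := fun x y => by
      have : ((x, y) : ℝ × ℝ) = x • (1, 0) + y • (0, 1) := by simp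
      rw [this, map_add, map_smul, map_smul, Complex.real_smul, Complex.real_smul]
    have d1 : HasDerivAt (fun x : ℝ => P θ (x * a) / (a : ℂ)) (D (0, a) / a) r := by
      refine HasDerivAt.div_const ?_ _
      have := (hasDerivAt_const r θ).prodMk ((hasDerivAt_id r).mul_const a)
      rw [one_mul] at this
      exact hPd.comp_hasDerivAt r (f := fun x => (θ, x * a)) this
    have d2 : HasDerivAt (fun s : ℝ => P (-Real.log (√(1 - s))) (r * √(1 - s)) / (√(1 - s) : ℂ))
        ((D (-(-(1 / (2 * a)) / a), r * -(1 / (2 * a))) * a - P θ (r * a) * (-(1 / (2 * a)) : ℝ)) /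
          (a : ℂ) ^ 2) t := by
      refine HasDerivAt.div ?_ hsd.ofReal_comp ha'
      exact hPd.comp_hasDerivAt t (f := fun s => (-Real.log (√(1 - s)), r * √(1 - s)))
        ((hsd.log ha.1.ne').neg.prodMk (hsd.const_mul r))
    have hexp : Real.exp θ = a⁻¹ := by rw [hθ_def, Real.exp_neg, Real.exp_log ha.1]
    have hra : r * a * Real.exp θ = r := by rw [hexp]; field_simp [ha.1.ne']
    have hθ0 : 0 ≤ θ := neg_nonneg.2 (Real.log_nonpos ha.1.le ha.2)
    have hSK : S θ (r * a) = r * a * q r * K r a := by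
      rw [← h.charKernel_eq_charSolution hθ0 (by rw [hra]; exact Ioo_subset_Icc_self hr)] at hK
      rw [hS_def, smoothSource, hra, hexp, hK]
      push_cast
      field_simp
    have hone : (1 - (t : ℂ)) = (a : ℂ) ^ 2 := by
      rw [← Complex.ofReal_pow, hsq2]; simp
    rw [d1.deriv, d2.deriv, hDlin 0 a, hDlin (-(-(1 / (2 * a)) / a)), hD1, hSK, hone]
    push_cast
    field_simp
    ring
  · intro r hr
    have := h.eq r hr 0 le_rfl
    simpa [charKernel, goursat] using this
  · intro t ht
    obtain ⟨C, -, hC⟩ := h.bound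
    have := hC 0 ⟨le_rfl, hρ⟩ (√(1 - t))
      ⟨Real.sqrt_nonneg _, Real.sqrt_le_one.2 (by linarith [ht.1])⟩
    simpa using this

/-! ### Uniqueness for the Goursat problem -/

/-- Mean value inequality on compact subintervals of (0, r), then limits at both ends, where `E` is
only known to be continuous. -/
theorem norm_le_of_norm_deriv_le_pow {E E' : ℝ → ℂ} {r c : ℝ} {n : ℕ} (hr : 0 < r) (hc : 0 ≤ c)
    (hE : ContinuousOn E (Icc 0 r)) (h0 : E 0 = 0) (hd : ∀ x ∈ Ioo 0 r, HasDerivAt E (E' x) x)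
    (hb : ∀ x ∈ Ioo 0 r, ‖E' x‖ ≤ c * x ^ n) : ‖E r‖ ≤ c * r ^ (n + 1) / (n + 1) := by
  have key : ∀ x₀ ∈ Ioo 0 r, ∀ x ∈ Ioo x₀ r, ‖E x - E x₀‖ ≤ c * r ^ (n + 1) / (n + 1) := by
    intro x₀ hx₀ x hx
    have hsub : Icc x₀ x ⊆ Ioo 0 r := fun y hy => ⟨hx₀.1.trans_le hy.1, hy.2.trans_lt hx.2⟩
    have hB : ∀ y, HasDerivAt (fun y : ℝ => c * (y ^ (n + 1) - x₀ ^ (n + 1)) / (n + 1))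
        (c * y ^ n) y := fun y => by
      refine ((((hasDerivAt_pow (n + 1) y).sub_const _).const_mul c).div_const _).congr_deriv ?_
      push_cast
      have : (n : ℝ) + 1 ≠ 0 := by positivity
      field_simp
    have := image_norm_le_of_norm_deriv_right_le_deriv_boundary (f := fun y => E y - E x₀)
      (f' := E') (a := x₀) (b := x) (fun y hy => ((hd y (hsub hy)).sub_const
        (E x₀)).continuousAt.continuousWithinAt)
      (fun y hy => ((hd y (hsub ⟨hy.1, hy.2.le⟩)).sub_const _).hasDerivWithinAt) (by simp) hB
      (fun y hy => hb y (hsub ⟨hy.1, hy.2.le⟩)) (right_mem_Icc.2 hx.1.le)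
    refine this.trans ?_
    have h1 : x ^ (n + 1) ≤ r ^ (n + 1) :=
      pow_le_pow_left₀ (hx₀.1.trans hx.1).le hx.2.le _
    have h2 : 0 ≤ x₀ ^ (n + 1) := pow_nonneg hx₀.1.le _
    gcongr
    linarith
  have l0 : Tendsto E (𝓝[>] 0) (𝓝 0) := by
    have := (hE 0 ⟨le_rfl, hr.le⟩).mono_left (nhdsWithin_le_of_mem (Icc_mem_nhdsGT hr))
    rwa [h0] at this
  have lr : Tendsto E (𝓝[<] r) (𝓝 (E r)) :=
    (hE r ⟨hr.le, le_rfl⟩).mono_left (nhdsWithin_le_of_mem (Icc_mem_nhdsLT hr))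
  have key2 : ∀ x₀ ∈ Ioo 0 r, ‖E r - E x₀‖ ≤ c * r ^ (n + 1) / (n + 1) := by
    intro x₀ hx₀
    refine le_of_tendsto (lr.sub_const (E x₀)).norm ?_
    filter_upwards [Ioo_mem_nhdsLT hx₀.2] with x hx using key x₀ hx₀ x hx
  have l1 : Tendsto (fun x => ‖E r - E x‖) (𝓝[>] 0) (𝓝 ‖E r - 0‖) := (l0.const_sub _).norm
  rw [sub_zero] at l1
  refine le_of_tendsto l1 ?_
  filter_upwards [Ioo_mem_nhdsGT hr] with x hx using key2 x hx

/-- The radial derivative of a kernel. -/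
noncomputable def radialDeriv (G : ℝ → ℝ → ℂ) (p : ℝ × ℝ) : ℂ :=
  fderiv ℝ (fun p : ℝ × ℝ => G p.1 p.2) p (1, 0)

namespace IsTransmutationKernel

variable {ρ : ℝ} {q : ℝ → ℂ} {G H : ℝ → ℝ → ℂ}

theorem hasDerivAt_radialDeriv (hG : IsTransmutationKernel ρ q G) {r t : ℝ} (hr : r ∈ Ioo 0 ρ)
    (ht : t ∈ Ioo (0 : ℝ) 1) : HasDerivAt (fun x => G x t) (radialDeriv G (r, t)) r := by
  have h := (hG.contDiffOn.contDiffAt ((isOpen_Ioo.prod isOpen_Ioo).mem_nhds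
    (⟨hr, ht⟩ : (r, t) ∈ Ioo 0 ρ ×ˢ Ioo (0 : ℝ) 1))).differentiableAt two_ne_zero
  exact h.hasFDerivAt.comp_hasDerivAt r (f := fun x => (x, t))
    ((hasDerivAt_id r).prodMk (hasDerivAt_const r t))

theorem differentiableAt_radialDeriv (hG : IsTransmutationKernel ρ q G) {r t : ℝ}
    (hr : r ∈ Ioo 0 ρ) (ht : t ∈ Ioo (0 : ℝ) 1) :
    DifferentiableAt ℝ (radialDeriv G) (r, t) := by
  have ho : IsOpen (Ioo 0 ρ ×ˢ Ioo (0 : ℝ) 1) := isOpen_Ioo.prod isOpen_Ioo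
  have h := ((hG.contDiffOn.fderiv_of_isOpen ho (m := 1) (by norm_num [one_add_one_eq_two])).clm_apply
    (contDiffOn_const (c := ((1, 0) : ℝ × ℝ)))).contDiffAt
    (ho.mem_nhds (⟨hr, ht⟩ : (r, t) ∈ Ioo 0 ρ ×ˢ Ioo (0 : ℝ) 1))
  exact h.differentiableAt one_ne_zero

/-- On the curve r²(1 - t) = k one has dt/dr = 2(1 - t) / r, and r G_rr - G_r + 2(1 - t) G_rt is r²
times the derivative of G_r / r along it. -/
theorem hasDerivAt_along_characteristic (hG : IsTransmutationKernel ρ q G) {s k : ℝ}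
    (hs : s ∈ Ioo 0 ρ) (hk : k ∈ Ioo 0 (s ^ 2)) :
    HasDerivAt (fun s : ℝ => radialDeriv G (s, 1 - k / s ^ 2) / (s : ℂ))
      (q s * G s (1 - k / s ^ 2) / (s : ℂ)) s := by
  have hs2 : 0 < s ^ 2 := hk.1.trans hk.2
  have ht : 1 - k / s ^ 2 ∈ Ioo (0 : ℝ) 1 :=
    ⟨sub_pos.2 ((div_lt_one hs2).2 hk.2), sub_lt_self _ (div_pos hk.1 hs2)⟩
  have hpde := hG.pde s hs _ ht
  have htv : ((1 - k / s ^ 2 : ℝ) : ℂ) = 1 - k / s ^ 2 := by push_cast; rfl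
  have hcurve : HasDerivAt (fun s : ℝ => 1 - k / s ^ 2) (2 * k / s ^ 3) s := by
    have := (((hasDerivAt_pow 2 s).inv hs2.ne').const_mul k).const_sub 1
    refine (this.congr_deriv ?_).congr_of_eventuallyEq (.of_forall fun x => ?_)
    · have := hs.1.ne'
      push_cast
      field_simp
    · simp [div_eq_mul_inv]
  set t := 1 - k / s ^ 2 with ht_def
  have e1 : (fun x => deriv (fun y => G y t) x) =ᶠ[𝓝 s] fun x => radialDeriv G (x, t) := by
    filter_upwards [Ioo_mem_nhds hs.1 hs.2] with x hx using (hG.hasDerivAt_radialDeriv hx ht).deriv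
  have e2 : (fun s' => deriv (fun x => G x s') s) =ᶠ[𝓝 t] fun s' => radialDeriv G (s, s') := by
    filter_upwards [Ioo_mem_nhds ht.1 ht.2] with x hx using (hG.hasDerivAt_radialDeriv hs hx).deriv
  have hd := (hG.differentiableAt_radialDeriv hs ht).hasFDerivAt
  set D := fderiv ℝ (radialDeriv G) (s, t)
  have d1 : HasDerivAt (fun x => radialDeriv G (x, t)) (D (1, 0)) s :=
    hd.comp_hasDerivAt s (f := fun x => (x, t)) ((hasDerivAt_id s).prodMk (hasDerivAt_const s t))
  have d2 : HasDerivAt (fun x => radialDeriv G (s, x)) (D (0, 1)) t :=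
    hd.comp_hasDerivAt t (f := fun x => (s, x)) ((hasDerivAt_const t s).prodMk (hasDerivAt_id t))
  rw [e1.deriv_eq, e2.deriv_eq, d1.deriv, d2.deriv,
    (hG.hasDerivAt_radialDeriv hs ht).deriv, htv] at hpde
  have hs' : (s : ℂ) ≠ 0 := Complex.ofReal_ne_zero.2 hs.1.ne'
  have d3 : HasDerivAt (fun s : ℝ => radialDeriv G (s, 1 - k / s ^ 2)) (D (1, 2 * k / s ^ 3)) s :=
    HasFDerivAt.comp_hasDerivAt s (f := fun s : ℝ => (s, 1 - k / s ^ 2)) hd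
      ((hasDerivAt_id s).prodMk hcurve)
  have hDlin : D (1, 2 * k / s ^ 3) = D (1, 0) + ((2 * k / s ^ 3 : ℝ) : ℂ) * D (0, 1) := by
    have : ((1, 2 * k / s ^ 3) : ℝ × ℝ) = (1, 0) + (2 * k / s ^ 3) • (0, 1) := by simp
    rw [this, map_add, map_smul, Complex.real_smul]
  refine (d3.div (hasDerivAt_id s).ofReal_comp hs').congr_deriv ?_
  rw [hDlin]
  push_cast
  simp only [id]
  rw [← ht_def]
  field_simp
  field_simp at hpde
  linear_combination hpde

/-- The point (x, t) is joined to (κx, t₀) on the same characteristic, with t₀ → 0, where both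
solutions have the same data. Integrating q(G - H) / s along the characteristic bounds the radial
derivative; integrating in r then gains one power. The restriction t ≤ τ < 1 keeps s ≥ √(1 - τ) x.
-/
theorem sub_bound_improves (hρ : 0 < ρ) (hG : IsTransmutationKernel ρ q G)
    (hH : IsTransmutationKernel ρ q H) {Q : ℝ} (hQ0 : 0 ≤ Q) (hQ : ∀ x ∈ Icc 0 ρ, ‖q x‖ ≤ Q)
    {τ : ℝ} (hτ : τ ∈ Ioo (0 : ℝ) 1) {n : ℕ} {A : ℝ} (hA : 0 ≤ A)
    (hb : ∀ r ∈ Ioo 0 ρ, ∀ t ∈ Ioc 0 τ, ‖G r t - H r t‖ ≤ A * r ^ n) {r t : ℝ}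
    (hr : r ∈ Ioo 0 ρ) (ht : t ∈ Ioc 0 τ) :
    ‖G r t - H r t‖ ≤ Q * ρ / √(1 - τ) * A * r ^ (n + 1) / (n + 1) := by
  have ha0 : 0 < √(1 - τ) := Real.sqrt_pos.2 (by linarith [hτ.2])
  have ht1 : t < 1 := ht.2.trans_lt hτ.2
  have hcd : ContinuousOn (fun p : ℝ × ℝ => G p.1 p.2 - H p.1 p.2) (Icc 0 ρ ×ˢ Icc 0 1) :=
    hG.continuousOn.sub hH.continuousOn
  -- This value solves x²(1 - t) = (κx)²(1 - t₀).
  set κ : ℝ → ℝ := fun t₀ => √((1 - t) / (1 - t₀)) with hκ_def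
  have step : ∀ t₀ ∈ Ioo 0 t, ‖(G r t - H r t) - ((κ t₀ ^ 2)⁻¹ : ℝ) *
      (G (κ t₀ * r) t₀ - H (κ t₀ * r) t₀)‖ ≤ Q * ρ / √(1 - τ) * A * r ^ (n + 1) / (n + 1) := by
    intro t₀ ht₀
    have ht₀1 : t₀ < 1 := ht₀.2.trans ht1
    have hκ2 : κ t₀ ^ 2 = (1 - t) / (1 - t₀) :=
      Real.sq_sqrt (div_nonneg (by linarith) (by linarith))
    have hκ1 : κ t₀ < 1 := by
      rw [hκ_def, Real.sqrt_lt' one_pos, one_pow, div_lt_one (by linarith)]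
      linarith [ht₀.2]
    have hκ0 : √(1 - τ) ≤ κ t₀ := by
      refine Real.sqrt_le_sqrt ?_
      rw [le_div_iff₀ (by linarith)]
      nlinarith [ht.2, ht₀.1, hτ.2]
    set k := κ t₀ with hk
    have hkpos : 0 < k := ha0.trans_le hκ0
    -- The weight κ⁻² makes the derivative equal to x (Z(x) - Z(κx)), where Z is the difference of
    -- the two quotients G_r / s and H_r / s along the characteristic.
    refine norm_le_of_norm_deriv_le_pow (E := fun x => (G x t - H x t) - ((k ^ 2)⁻¹ : ℝ) *
      (G (k * x) t₀ - H (k * x) t₀)) (E' := fun x => (radialDeriv G (x, t) - radialDeriv H (x, t)) -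
      ((k ^ 2)⁻¹ : ℝ) * (k • (radialDeriv G (k * x, t₀) - radialDeriv H (k * x, t₀)))) hr.1
      (by positivity) ?_ ?_ ?_ ?_
    · refine ContinuousOn.sub ?_ (continuousOn_const.mul ?_)
      · exact hcd.comp (f := fun x => (x, t)) (Continuous.continuousOn (by fun_prop)) fun x hx =>
          ⟨⟨hx.1, hx.2.trans hr.2.le⟩, ht.1.le, ht1.le⟩
      · refine hcd.comp (f := fun x => (k * x, t₀)) (Continuous.continuousOn (by fun_prop))
          fun x hx => ⟨⟨mul_nonneg hkpos.le hx.1, ?_⟩, ht₀.1.le, ht₀1.le⟩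
        exact (mul_le_of_le_one_left hx.1 hκ1.le).trans (hx.2.trans hr.2.le)
    · have z : ∀ s ∈ Icc (0 : ℝ) 1, G 0 s - H 0 s = 0 := fun s hs => by
        rw [hG.initial_r s hs, hH.initial_r s hs, sub_zero]
      simp [z t ⟨ht.1.le, ht1.le⟩, z t₀ ⟨ht₀.1.le, ht₀1.le⟩]
    · intro x hx
      have hxm : x ∈ Ioo 0 ρ := ⟨hx.1, hx.2.trans hr.2⟩
      have hkx : k * x ∈ Ioo 0 ρ := ⟨mul_pos hkpos hx.1,
        (mul_lt_of_lt_one_left hx.1 hκ1).trans hxm.2⟩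
      have htm : t ∈ Ioo (0 : ℝ) 1 := ⟨ht.1, ht1⟩
      have ht₀m : t₀ ∈ Ioo (0 : ℝ) 1 := ⟨ht₀.1, ht₀1⟩
      have hlin : HasDerivAt (fun x => k * x) k x := by
        simpa using (hasDerivAt_id x).const_mul k
      refine ((hG.hasDerivAt_radialDeriv hxm htm).sub (hH.hasDerivAt_radialDeriv hxm htm)).sub
        (HasDerivAt.const_mul _ ?_)
      exact HasDerivAt.scomp x (g₁ := fun x => G x t₀ - H x t₀) (h := fun x => k * x)
        ((hG.hasDerivAt_radialDeriv hkx ht₀m).sub (hH.hasDerivAt_radialDeriv hkx ht₀m)) hlin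
    · intro x hx
      have hxm : x ∈ Ioo 0 ρ := ⟨hx.1, hx.2.trans hr.2⟩
      have hx0 : (x : ℂ) ≠ 0 := Complex.ofReal_ne_zero.2 hx.1.ne'
      have hk0 : (k : ℂ) ≠ 0 := Complex.ofReal_ne_zero.2 hkpos.ne'
      set m := x ^ 2 * (1 - t) with hm
      set Z : ℝ → ℂ := fun s => radialDeriv G (s, 1 - m / s ^ 2) / (s : ℂ) -
        radialDeriv H (s, 1 - m / s ^ 2) / (s : ℂ) with hZ
      have hm0 : 0 < m := mul_pos (pow_pos hx.1 2) (by linarith)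
      have m1 : 1 - m / x ^ 2 = t := by
        rw [hm, mul_div_cancel_left₀ _ (pow_pos hx.1 2).ne']; ring
      have m2 : 1 - m / (k * x) ^ 2 = t₀ := by
        have h1 : (1 - t) ≠ 0 := by linarith
        have h2 : (1 - t₀) ≠ 0 := by linarith
        have h3 := hx.1.ne'
        rw [mul_pow, hκ2, hm]
        field_simp
        ring
      have hZeq : (radialDeriv G (x, t) - radialDeriv H (x, t)) - ((k ^ 2)⁻¹ : ℝ) *
          (k • (radialDeriv G (k * x, t₀) - radialDeriv H (k * x, t₀))) = x * (Z x - Z (k * x)) := by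
        rw [hZ]
        simp only [m1, m2, Complex.real_smul]
        push_cast
        field_simp
      have hZd : ∀ s ∈ Icc (k * x) x, HasDerivWithinAt Z (q s * G s (1 - m / s ^ 2) / (s : ℂ) -
          q s * H s (1 - m / s ^ 2) / (s : ℂ)) (Icc (k * x) x) s ∧
          ‖q s * G s (1 - m / s ^ 2) / (s : ℂ) - q s * H s (1 - m / s ^ 2) / (s : ℂ)‖ ≤
            Q * (A * x ^ n) / (√(1 - τ) * x) := by
        intro s hs
        have hs0 : 0 < s := (mul_pos hkpos hx.1).trans_le hs.1
        have hsm : s ∈ Ioo 0 ρ := ⟨hs0, hs.2.trans_lt hxm.2⟩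
        have hle : (k * x) ^ 2 ≤ s ^ 2 := pow_le_pow_left₀ (mul_pos hkpos hx.1).le hs.1 2
        have hmlt : m / (k * x) ^ 2 < 1 := by linarith [ht₀.1]
        have hms : m / s ^ 2 ≤ m / (k * x) ^ 2 := by
          have := mul_pos hkpos hx.1
          gcongr
        have hms' : m / x ^ 2 ≤ m / s ^ 2 := by
          have := hs.2
          gcongr
        have hmm : m ∈ Ioo 0 (s ^ 2) := ⟨hm0, (div_lt_one (pow_pos hs0 2)).1 (hms.trans_lt hmlt)⟩
        refine ⟨((hG.hasDerivAt_along_characteristic hsm hmm).sub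
          (hH.hasDerivAt_along_characteristic hsm hmm)).hasDerivWithinAt, ?_⟩
        have htau : 1 - m / s ^ 2 ∈ Ioc 0 τ := ⟨by linarith, by linarith [ht.2]⟩
        rw [← sub_div, ← mul_sub, norm_div, norm_mul, Complex.norm_real, Real.norm_of_nonneg hs0.le]
        have h1 : √(1 - τ) * x ≤ s := (mul_le_mul_of_nonneg_right hκ0 hx.1.le).trans hs.1
        have h2 : 0 < √(1 - τ) * x := mul_pos ha0 hx.1
        gcongr
        · exact mul_nonneg hQ0 (mul_nonneg hA (pow_nonneg hx.1.le n))
        · exact hQ s (Ioo_subset_Icc_self hsm)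
        · refine (hb s hsm _ htau).trans ?_
          gcongr
          exact hs.2
      have hmv := (convex_Icc (k * x) x).norm_image_sub_le_of_norm_hasDerivWithin_le
        (fun s hs => (hZd s hs).1) (fun s hs => (hZd s hs).2)
        (left_mem_Icc.2 (mul_le_of_le_one_left hx.1.le hκ1.le))
        (right_mem_Icc.2 (mul_le_of_le_one_left hx.1.le hκ1.le))
      rw [hZeq, norm_mul, Complex.norm_real, Real.norm_of_nonneg hx.1.le]
      have hxk : ‖x - k * x‖ ≤ x := by
        rw [Real.norm_of_nonneg (by nlinarith [hx.1])]
        linarith [mul_pos hkpos hx.1]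
      have hxn : 0 ≤ x ^ n := pow_nonneg hx.1.le n
      have hx1 := hx.1
      have hxρ : x ≤ ρ := hxm.2.le
      calc x * ‖Z x - Z (k * x)‖ ≤ x * (Q * (A * x ^ n) / (√(1 - τ) * x) * x) := by
            gcongr
            exact hmv.trans (by gcongr)
        _ = Q * x / √(1 - τ) * A * x ^ n := by field_simp
        _ ≤ Q * ρ / √(1 - τ) * A * x ^ n := by gcongr
  -- The edge t = 0 is reached only by continuity, because the solutions are C² only in the open
  -- rectangle.
  have hlim : Tendsto (fun t₀ => ‖(G r t - H r t) - ((κ t₀ ^ 2)⁻¹ : ℝ) *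
      (G (κ t₀ * r) t₀ - H (κ t₀ * r) t₀)‖) (𝓝[>] 0) (𝓝 ‖G r t - H r t‖) := by
    have hκc : Tendsto κ (𝓝[>] 0) (𝓝 (√(1 - t))) := by
      have : ContinuousAt κ 0 :=
        (continuousAt_const.div (continuousAt_const.sub continuousAt_id) (by simp)).sqrt
      have h2 := this.tendsto
      simp only [hκ_def, sub_zero, div_one] at h2
      exact h2.mono_left nhdsWithin_le_nhds
    have hkt0 : 0 < √(1 - t) := Real.sqrt_pos.2 (by linarith)
    have hkt1 : √(1 - t) < 1 := by
      rw [Real.sqrt_lt' one_pos]; linarith [ht.1]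
    have hm : √(1 - t) * r ∈ Ioo 0 ρ := ⟨mul_pos hkt0 hr.1,
      (mul_lt_of_lt_one_left hr.1 hkt1).trans hr.2⟩
    have h1 : Tendsto (fun t₀ => G (κ t₀ * r) t₀ - H (κ t₀ * r) t₀) (𝓝[>] 0)
        (𝓝 (G (√(1 - t) * r) 0 - H (√(1 - t) * r) 0)) := by
      have hmt : Tendsto (fun t₀ => (κ t₀ * r, t₀)) (𝓝[>] 0) (𝓝 (√(1 - t) * r, (0 : ℝ))) :=
        (hκc.mul_const r).prodMk_nhds (tendsto_id.mono_left nhdsWithin_le_nhds)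
      have hev : ∀ᶠ t₀ in 𝓝[>] (0 : ℝ), (κ t₀ * r, t₀) ∈ Icc 0 ρ ×ˢ Icc (0 : ℝ) 1 := by
        filter_upwards [(hκc.mul_const r).eventually (Ioo_mem_nhds hm.1 hm.2),
          Ioo_mem_nhdsGT one_pos] with t₀ h1 h2
        exact ⟨Ioo_subset_Icc_self h1, Ioo_subset_Icc_self h2⟩
      exact (hcd (√(1 - t) * r, 0) ⟨Ioo_subset_Icc_self hm, by simp⟩).tendsto.comp
        (tendsto_nhdsWithin_iff.2 ⟨hmt, hev⟩)
    rw [hG.initial_t _ (Ioo_subset_Icc_self hm), hH.initial_t _ (Ioo_subset_Icc_self hm),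
      sub_self] at h1
    have h2 : Tendsto (fun t₀ => (((κ t₀ ^ 2)⁻¹ : ℝ) : ℂ)) (𝓝[>] 0)
        (𝓝 (((√(1 - t) ^ 2)⁻¹ : ℝ) : ℂ)) :=
      (Complex.continuous_ofReal.tendsto _).comp ((hκc.pow 2).inv₀ (pow_pos hkt0 2).ne')
    have h3 := ((h2.mul h1).const_sub (G r t - H r t)).norm
    rwa [mul_zero, sub_zero] at h3
  refine le_of_tendsto hlim ?_
  filter_upwards [Ioo_mem_nhdsGT ht.1] with t₀ ht₀ using step t₀ ht₀

theorem eqOn (hρ : 0 < ρ) (hq : ContinuousOn q (Icc 0 ρ)) (hG : IsTransmutationKernel ρ q G)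
    (hH : IsTransmutationKernel ρ q H) :
    ∀ r ∈ Icc 0 ρ, ∀ t ∈ Icc (0 : ℝ) 1, G r t = H r t := by
  obtain ⟨Q, hQ⟩ := isCompact_Icc.exists_bound_of_continuousOn hq
  have hQ0 : 0 ≤ Q := (norm_nonneg _).trans (hQ 0 ⟨le_rfl, hρ.le⟩)
  obtain ⟨M, hM⟩ := (isCompact_Icc.prod isCompact_Icc).exists_bound_of_continuousOn
    (hG.continuousOn.sub hH.continuousOn)
  have hin : EqOn (fun p : ℝ × ℝ => G p.1 p.2) (fun p => H p.1 p.2)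
      (Ioo 0 ρ ×ˢ Ioo (0 : ℝ) 1) := by
    rintro ⟨r, t⟩ ⟨hr, ht⟩
    -- The constant blows up as t → 1, so the iteration runs below a fixed t; density and continuity
    -- then cover the closed rectangle.
    have := eq_zero_of_pow_bound_improves (s := Ioo 0 ρ ×ˢ Ioc 0 t)
      (N := fun p : ℝ × ℝ => ‖G p.1 p.2 - H p.1 p.2‖) (ℓ := fun p => p.1) (M := M)
      (C := Q * ρ / √(1 - t)) (fun _ _ => norm_nonneg _)
      (fun p hp => hM p ⟨Ioo_subset_Icc_self hp.1, hp.2.1.le, hp.2.2.trans ht.2.le⟩)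
      (fun n A hA hb p hp => sub_bound_improves hρ hG hH hQ0 hQ ht hA
        (fun r hr t ht => hb (r, t) ⟨hr, ht⟩) hp.1 hp.2) (by positivity) (r, t)
        ⟨hr, ht.1, le_rfl⟩
    exact sub_eq_zero.1 (norm_eq_zero.1 this)
  have hcl := hin.of_subset_closure hG.continuousOn hH.continuousOn
    (prod_mono Ioo_subset_Icc_self Ioo_subset_Icc_self)
    (by rw [closure_prod_eq, closure_Ioo hρ.ne, closure_Ioo zero_ne_one])
  exact fun r hr t ht => hcl (⟨hr, ht⟩ : (r, t) ∈ Icc 0 ρ ×ˢ Icc (0 : ℝ) 1)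

end IsTransmutationKernel

/-! ### The Darboux relation between the two kernels -/

/-- The potentials `q` and `p` are exchanged by the Darboux transform with logarithmic derivative
`ψ`. -/
structure IsDarbouxPair (ρ : ℝ) (q p ψ : ℝ → ℂ) : Prop where
  continuous_left : Continuous q
  continuous_right : Continuous p
  continuous_log : Continuous ψ
  add_eq : ∀ r ∈ Icc 0 ρ, q r + p r = 2 * ψ r ^ 2
  riccati : ∀ r ∈ Ioo 0 ρ, HasDerivAt (fun s : ℝ => (s : ℂ) * ψ s) (r * (q r - ψ r ^ 2)) r

/-- The relation q + p = 2ψ² reads q - ψ² = -(p - ψ²), so the Riccati equation is invariant under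
exchanging the potentials and ψ ↦ -ψ. -/
theorem IsDarbouxPair.symm {ρ : ℝ} {q p ψ : ℝ → ℂ} (h : IsDarbouxPair ρ q p ψ) :
    IsDarbouxPair ρ p q (fun r => -ψ r) where
  continuous_left := h.continuous_right
  continuous_right := h.continuous_left
  continuous_log := h.continuous_log.neg
  add_eq r hr := by linear_combination h.add_eq r hr
  riccati r hr := by
    refine ((h.riccati r hr).neg.congr_deriv ?_).congr_of_eventuallyEq
      (.of_forall fun s => by simp)
    linear_combination -(r : ℂ) * h.add_eq r (Ioo_subset_Icc_self hr)

/-- The radial derivative `K_r(r, a)` of a profile. -/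
noncomputable def profileDeriv (q : ℝ → ℂ) (K : ℝ → ℝ → ℂ) (r a : ℝ) : ℂ :=
  charSolutionDeriv q (charSource q K) (-Real.log a) (r * a) / a

theorem mul_exp_neg_log {a : ℝ} (ha : 0 < a) (r : ℝ) : r * a * Real.exp (-Real.log a) = r := by
  rw [Real.exp_neg, Real.exp_log ha, mul_assoc, mul_inv_cancel₀ ha.ne', mul_one]

theorem continuous_charSolutionDeriv {q : ℝ → ℂ} {S : ℝ → ℝ → ℂ} (hq : Continuous q)
    (hS : Continuous ↿S) : Continuous ↿(charSolutionDeriv q S) :=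
  (by fun_prop : Continuous fun z : ℝ × ℝ => (z.2 : ℂ) * q z.2).add (continuous_integral_left hS)

theorem continuousOn_profileDeriv {q : ℝ → ℂ} {K : ℝ → ℝ → ℂ} (hq : Continuous q)
    (hK : Continuous ↿K) (r : ℝ) : ContinuousOn (profileDeriv q K r) (Ioi 0) := by
  have h := continuous_charSolutionDeriv hq (continuous_charSource hq hK)
  have hne : ∀ a ∈ Ioi (0 : ℝ), a ≠ 0 := fun a ha => ne_of_gt ha
  refine ContinuousOn.div (h.comp_continuousOn (f := fun a => (-Real.log a, r * a)) ?_)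
    Complex.continuous_ofReal.continuousOn fun a ha => Complex.ofReal_ne_zero.2 (hne a ha)
  exact (continuousOn_id.log hne).neg.prodMk (continuousOn_const.mul continuousOn_id)

/-! ### Radial derivative of a profile and bounds near w = 0. -/

namespace IsProfile

variable {ρ : ℝ} {q : ℝ → ℂ} {K : ℝ → ℝ → ℂ}

theorem sq_mul_eq (h : IsProfile ρ q K) {r a : ℝ} (hr : r ∈ Icc 0 ρ) (ha : a ∈ Ioc (0 : ℝ) 1) :
    (a : ℂ) ^ 2 * K r a = charKernel q K (-Real.log a) (r * a) := by
  rw [h.charKernel_eq (neg_nonneg.2 (Real.log_nonpos ha.1.le ha.2))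
    (by rwa [mul_exp_neg_log ha.1]), mul_exp_neg_log ha.1, neg_neg, Real.exp_log ha.1]

theorem hasDerivAt (h : IsProfile ρ q K) (hq : Continuous q) {r a : ℝ} (hr : r ∈ Ioo 0 ρ)
    (ha : a ∈ Ioc (0 : ℝ) 1) : HasDerivAt (fun x => K x a) (profileDeriv q K r a) r := by
  have ha' : (a : ℂ) ≠ 0 := Complex.ofReal_ne_zero.2 ha.1.ne'
  have h1 : HasDerivAt (fun x : ℝ => charKernel q K (-Real.log a) (x * a) / (a : ℂ) ^ 2)
      (a • charSolutionDeriv q (charSource q K) (-Real.log a) (r * a) / (a : ℂ) ^ 2) r := by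
    refine HasDerivAt.div_const (HasDerivAt.scomp r (g₁ := charKernel q K (-Real.log a))
      (h := fun x => x * a)
      (hasDerivAt_charSolution_snd hq (continuous_charSource hq h.continuous) _ _) ?_) _
    simpa using (hasDerivAt_id r).mul_const a
  refine (h1.congr_of_eventuallyEq ?_).congr_deriv ?_
  · filter_upwards [Ioo_mem_nhds hr.1 hr.2] with x hx
    rw [← h.sq_mul_eq (Ioo_subset_Icc_self hx) ha]
    field_simp
  · rw [profileDeriv, Complex.real_smul]
    field_simp

theorem norm_charKernel_le (h : IsProfile ρ q K) : ∃ C, 0 ≤ C ∧ ∀ θ w : ℝ, 0 ≤ θ →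
    w * Real.exp θ ∈ Icc 0 ρ → ‖charKernel q K θ w‖ ≤ C * w ^ 2 := by
  obtain ⟨C, hC0, hC⟩ := h.bound
  refine ⟨C, hC0, fun θ w hθ hw => ?_⟩
  have he : Real.exp (-θ) ^ 2 * Real.exp θ ^ 2 = 1 := by
    rw [← mul_pow, ← Real.exp_add]; simp
  rw [h.charKernel_eq hθ hw, norm_mul, norm_pow, Complex.norm_real,
    Real.norm_of_nonneg (Real.exp_pos _).le]
  calc _ ≤ Real.exp (-θ) ^ 2 * (C * (w * Real.exp θ) ^ 2) := by
        gcongr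
        exact hC _ hw _ ⟨(Real.exp_pos _).le, Real.exp_le_one_iff.2 (by linarith)⟩
    _ = C * w ^ 2 := by linear_combination C * w ^ 2 * he

/-- The source is at most QCw³e^{2η}; its η-integral is at most QCw(we^θ)² / 2, and we^θ ≤ ρ makes
this uniform in θ. -/
theorem norm_charSolutionDeriv_le (hρ : 0 ≤ ρ) (h : IsProfile ρ q K) (hq : Continuous q) :
    ∃ C, 0 ≤ C ∧ ∀ θ w : ℝ, 0 ≤ θ → 0 ≤ w → w * Real.exp θ ≤ ρ →
      ‖charSolutionDeriv q (charSource q K) θ w‖ ≤ C * w := by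
  obtain ⟨C, hC0, hC⟩ := h.bound
  obtain ⟨Q, hQ⟩ := isCompact_Icc.exists_bound_of_continuousOn (s := Icc 0 ρ) hq.continuousOn
  have hQ0 : 0 ≤ Q := (norm_nonneg _).trans (hQ 0 ⟨le_rfl, hρ⟩)
  refine ⟨Q + Q * C * ρ ^ 2 / 2, by positivity, fun θ w hθ hw hwρ => ?_⟩
  have h1 : w ≤ ρ := (le_mul_of_one_le_right hw (Real.one_le_exp hθ)).trans hwρ
  have hS := intervalIntegral.norm_integral_le_of_norm_le (a := 0) (b := θ) (μ := volume)
    (f := fun η => charSource q K η w)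
    (g := fun η => Q * C * w ^ 3 * (Real.exp η * Real.exp η)) hθ (.of_forall fun η hη => ?_)
    (Continuous.intervalIntegrable (by fun_prop) _ _)
  · have hI : ∫ η in (0 : ℝ)..θ, Real.exp η * Real.exp η = (Real.exp θ ^ 2 - 1) / 2 := by
      have : ∀ η ∈ uIcc 0 θ, HasDerivAt (fun η => Real.exp η ^ 2 / 2) (Real.exp η * Real.exp η) η :=
        fun η _ => by
          refine (((Real.hasDerivAt_exp η).pow 2).div_const 2).congr_deriv ?_
          push_cast
          ring
      rw [intervalIntegral.integral_eq_sub_of_hasDerivAt this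
        (Continuous.intervalIntegrable (by fun_prop) _ _)]
      simp
      ring
    rw [intervalIntegral.integral_const_mul, hI] at hS
    rw [charSolutionDeriv]
    refine (norm_add_le _ _).trans ?_
    rw [norm_mul, Complex.norm_real, Real.norm_of_nonneg hw]
    have h2 : w * ‖q w‖ ≤ w * Q := by
      gcongr
      exact hQ w ⟨hw, h1⟩
    have h3 : (w * Real.exp θ) ^ 2 ≤ ρ ^ 2 :=
      pow_le_pow_left₀ (mul_nonneg hw (Real.exp_pos _).le) hwρ 2
    have h4 : Q * C * w ^ 3 * ((Real.exp θ ^ 2 - 1) / 2) ≤ Q * C * ρ ^ 2 / 2 * w := by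
      have : Q * C * w * (w * Real.exp θ) ^ 2 ≤ Q * C * w * ρ ^ 2 := by gcongr
      have : 0 ≤ Q * C * w ^ 3 := by positivity
      nlinarith
    linarith
  · have hη0 : 0 ≤ η := hη.1.le
    have hm : w * Real.exp η ∈ Icc 0 ρ := ⟨mul_nonneg hw (Real.exp_pos _).le,
      (mul_le_mul_of_nonneg_left (Real.exp_le_exp.2 hη.2) hw).trans hwρ⟩
    rw [charSource, norm_mul, norm_mul, Complex.norm_real, Real.norm_of_nonneg hw]
    calc _ ≤ w * Q * (C * (w * Real.exp η) ^ 2) := by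
          gcongr
          · exact hQ _ hm
          · exact hC _ hm _ ⟨(Real.exp_pos _).le, Real.exp_le_one_iff.2 (by linarith)⟩
      _ = _ := by ring

/-- A bound linear in w = ra survives division by a. Boundedness of K_r as a → 0, without continuity
there, is what differentiation under the integral needs. -/
theorem norm_profileDeriv_le (hρ : 0 ≤ ρ) (h : IsProfile ρ q K) (hq : Continuous q) :
    ∃ C, 0 ≤ C ∧ ∀ r ∈ Icc 0 ρ, ∀ a ∈ Ioc (0 : ℝ) 1, ‖profileDeriv q K r a‖ ≤ C := by
  obtain ⟨C, hC0, hC⟩ := h.norm_charSolutionDeriv_le hρ hq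
  refine ⟨C * ρ, by positivity, fun r hr a ha => ?_⟩
  have := hC (-Real.log a) (r * a) (neg_nonneg.2 (Real.log_nonpos ha.1.le ha.2))
    (mul_nonneg hr.1 ha.1.le) (by rw [mul_exp_neg_log ha.1]; exact hr.2)
  rw [profileDeriv, norm_div, Complex.norm_real, Real.norm_of_nonneg ha.1.le, div_le_iff₀ ha.1]
  refine this.trans ?_
  rw [← mul_assoc]
  have := ha.1.le
  have := hr.2
  gcongr

end IsProfile

/-- The residuals of the first order system satisfied by the two kernels. -/
noncomputable def residualFst (q p ψ : ℝ → ℂ) (K K' : ℝ → ℝ → ℂ) (θ w : ℝ) : ℂ :=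
  (charSolutionDeriv q (charSource q K) θ w + charSolutionDeriv p (charSource p K') θ w) / w +
    ((w * Real.exp θ : ℝ) : ℂ) * ψ (w * Real.exp θ) *
      (charKernel p K' θ w - charKernel q K θ w) / (w : ℂ) ^ 2

/-- The two integrals are the θ-derivatives of the kernels in characteristic coordinates, so the
vanishing of both residuals is a first order system for the pair. -/
noncomputable def residualSnd (q p ψ : ℝ → ℂ) (K K' : ℝ → ℝ → ℂ) (θ w : ℝ) : ℂ :=
  ((w * Real.exp θ : ℝ) : ℂ) * ψ (w * Real.exp θ) * (charKernel q K θ w + charKernel p K' θ w) -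
    ((∫ v in (0 : ℝ)..w, charSource q K θ v) - ∫ v in (0 : ℝ)..w, charSource p K' θ v)

/-! ### Vanishing of the residuals and the first order relation. -/

namespace IsDarbouxPair

variable {ρ : ℝ} {q p ψ : ℝ → ℂ} {K K' : ℝ → ℝ → ℂ}

/-- The mixed derivatives J_θw are the sources and the derivative of rψ is given by the Riccati
equation; q + p = 2ψ² then collapses everything into a multiple of the other residual. -/
theorem hasDerivAt_residualFst (hD : IsDarbouxPair ρ q p ψ) (hK : IsProfile ρ q K)
    (hK' : IsProfile ρ p K') {θ w : ℝ} (hθ : 0 ≤ θ) (hw : 0 < w) (hwρ : w * Real.exp θ < ρ) :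
    HasDerivAt (fun θ => residualFst q p ψ K K' θ w)
      (((w * Real.exp θ : ℝ) : ℂ) * ψ (w * Real.exp θ) / (w : ℂ) ^ 2 *
        residualSnd q p ψ K K' θ w) θ := by
  have hS := continuous_charSource hD.continuous_left hK.continuous
  have hS' := continuous_charSource hD.continuous_right hK'.continuous
  have hm : w * Real.exp θ ∈ Ioo 0 ρ := ⟨by positivity, hwρ⟩
  have hφ : HasDerivAt (fun θ : ℝ => ((w * Real.exp θ : ℝ) : ℂ) * ψ (w * Real.exp θ))
      ((w * Real.exp θ) • (((w * Real.exp θ : ℝ) : ℂ) *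
        (q (w * Real.exp θ) - ψ (w * Real.exp θ) ^ 2))) θ :=
    HasDerivAt.scomp θ (g₁ := fun s : ℝ => (s : ℂ) * ψ s) (hD.riccati _ hm)
      ((Real.hasDerivAt_exp θ).const_mul w)
  have h1 := ((hasDerivAt_charSolutionDeriv_fst (q := q) hS θ w).add
    (hasDerivAt_charSolutionDeriv_fst (q := p) hS' θ w)).div_const (w : ℂ)
  have h2 := (hφ.mul ((hasDerivAt_charSolution_fst (q := p) hS' θ w).sub
    (hasDerivAt_charSolution_fst (q := q) hS θ w))).div_const ((w : ℂ) ^ 2)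
  refine (h1.add h2).congr_deriv ?_
  have hw' : (w : ℂ) ≠ 0 := Complex.ofReal_ne_zero.2 hw.ne'
  rw [hK.charSource_eq hθ (Ioo_subset_Icc_self hm), hK'.charSource_eq hθ (Ioo_subset_Icc_self hm),
    smoothSource, smoothSource, residualSnd, Complex.real_smul]
  change _ + (_ * (charKernel p K' θ w - charKernel q K θ w) + _) / _ = _
  have hadd := hD.add_eq _ (Ioo_subset_Icc_self hm)
  push_cast
  field_simp
  linear_combination (charKernel p K' θ w) * w * Complex.exp θ * hadd

theorem hasDerivAt_residualSnd (hD : IsDarbouxPair ρ q p ψ) (hK : IsProfile ρ q K)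
    (hK' : IsProfile ρ p K') {θ w : ℝ} (hθ : 0 ≤ θ) (hw : 0 < w) (hwρ : w * Real.exp θ < ρ) :
    HasDerivAt (residualSnd q p ψ K K' θ)
      (((w * Real.exp θ : ℝ) : ℂ) * ψ (w * Real.exp θ) * w * residualFst q p ψ K K' θ w) w := by
  have hS := continuous_charSource hD.continuous_left hK.continuous
  have hS' := continuous_charSource hD.continuous_right hK'.continuous
  have hm : w * Real.exp θ ∈ Ioo 0 ρ := ⟨by positivity, hwρ⟩
  have hφ : HasDerivAt (fun w : ℝ => ((w * Real.exp θ : ℝ) : ℂ) * ψ (w * Real.exp θ))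
      (Real.exp θ • (((w * Real.exp θ : ℝ) : ℂ) *
        (q (w * Real.exp θ) - ψ (w * Real.exp θ) ^ 2))) w := by
    refine HasDerivAt.scomp w (g₁ := fun s : ℝ => (s : ℂ) * ψ s) (h := fun w => w * Real.exp θ)
      (hD.riccati _ hm) ?_
    simpa using (hasDerivAt_id w).mul_const (Real.exp θ)
  have h1 := (hasDerivAt_integral_of_continuous (g := charSource q K θ)
    (hS.comp (by fun_prop : Continuous fun v => (θ, v))) 0 w).sub
    (hasDerivAt_integral_of_continuous (g := charSource p K' θ)
    (hS'.comp (by fun_prop : Continuous fun v => (θ, v))) 0 w)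
  have h2 := hφ.mul ((hasDerivAt_charSolution_snd hD.continuous_left hS θ w).add
    (hasDerivAt_charSolution_snd hD.continuous_right hS' θ w))
  refine (h2.sub h1).congr_deriv ?_
  have hw' : (w : ℂ) ≠ 0 := Complex.ofReal_ne_zero.2 hw.ne'
  rw [hK.charSource_eq hθ (Ioo_subset_Icc_self hm), hK'.charSource_eq hθ (Ioo_subset_Icc_self hm),
    smoothSource, smoothSource, residualFst, Complex.real_smul]
  change _ * (charKernel q K θ w + charKernel p K' θ w) + _ - _ = _
  have hadd := hD.add_eq _ (Ioo_subset_Icc_self hm)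
  push_cast
  field_simp
  linear_combination (charKernel p K' θ w) * Complex.exp θ * hadd

/-- By the pair relations (rψ)' = r(q - ψ²) = r(q - p) / 2, and rψ vanishes at 0. -/
theorem integral_sub_eq (hD : IsDarbouxPair ρ q p ψ) {w : ℝ} (hw : 0 ≤ w) (hwρ : w ≤ ρ) :
    (∫ v in (0 : ℝ)..w, (v : ℂ) * p v) - ∫ v in (0 : ℝ)..w, (v : ℂ) * q v = -2 * (w * ψ w) := by
  have hq := hD.continuous_left
  have hp := hD.continuous_right
  have hψ := hD.continuous_log
  have h1 := intervalIntegral.integral_eq_sub_of_hasDerivAt_of_le (a := 0) (b := w)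
    (f := fun s : ℝ => (s : ℂ) * ψ s) (f' := fun s : ℝ => (s : ℂ) * (q s - ψ s ^ 2)) hw
    (by fun_prop) (fun x hx => hD.riccati x ⟨hx.1, hx.2.trans_le hwρ⟩)
    (Continuous.intervalIntegrable (by fun_prop) _ _)
  rw [← intervalIntegral.integral_sub (Continuous.intervalIntegrable (by fun_prop) _ _)
    (Continuous.intervalIntegrable (by fun_prop) _ _)]
  simp only [Complex.ofReal_zero, zero_mul, sub_zero] at h1
  rw [← h1, ← intervalIntegral.integral_const_mul]
  refine intervalIntegral.integral_congr fun v hv => ?_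
  rw [uIcc_of_le hw] at hv
  have := hD.add_eq v ⟨hv.1, hv.2.trans hwρ⟩
  linear_combination (v : ℂ) * this

theorem residualFst_zero (hD : IsDarbouxPair ρ q p ψ) {w : ℝ} (hw : 0 < w) (hwρ : w < ρ) :
    residualFst q p ψ K K' 0 w = 0 := by
  have hw' : (w : ℂ) ≠ 0 := Complex.ofReal_ne_zero.2 hw.ne'
  have hadd := hD.add_eq w ⟨hw.le, hwρ.le⟩
  simp only [residualFst, charSolutionDeriv, charKernel, goursat, intervalIntegral.integral_same,
    intervalIntegral.integral_zero, add_zero, Real.exp_zero, mul_one,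
    hD.integral_sub_eq hw.le hwρ.le]
  field_simp
  linear_combination hadd

theorem exists_bound_residualFst (hρ : 0 < ρ) (hD : IsDarbouxPair ρ q p ψ) (hK : IsProfile ρ q K)
    (hK' : IsProfile ρ p K') : ∃ M, ∀ θ w : ℝ, 0 ≤ θ → 0 < w → w * Real.exp θ < ρ →
      ‖residualFst q p ψ K K' θ w‖ ≤ M := by
  obtain ⟨C₁, h₁0, h₁⟩ := hK.norm_charSolutionDeriv_le hρ.le hD.continuous_left
  obtain ⟨C₂, h₂0, h₂⟩ := hK'.norm_charSolutionDeriv_le hρ.le hD.continuous_right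
  obtain ⟨C₃, h₃0, h₃⟩ := hK.norm_charKernel_le
  obtain ⟨C₄, h₄0, h₄⟩ := hK'.norm_charKernel_le
  obtain ⟨B, hB⟩ := isCompact_Icc.exists_bound_of_continuousOn (s := Icc 0 ρ)
    hD.continuous_log.continuousOn
  have hB0 : 0 ≤ B := (norm_nonneg _).trans (hB 0 ⟨le_rfl, hρ.le⟩)
  refine ⟨(C₁ + C₂) + ρ * B * (C₄ + C₃), fun θ w hθ hw hwρ => ?_⟩
  have hm : w * Real.exp θ ∈ Icc 0 ρ := ⟨by positivity, hwρ.le⟩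
  refine (norm_add_le _ _).trans (add_le_add ?_ ?_)
  · rw [norm_div, Complex.norm_real, Real.norm_of_nonneg hw.le, div_le_iff₀ hw, add_mul]
    exact (norm_add_le _ _).trans (add_le_add (h₁ θ w hθ hw.le hwρ.le) (h₂ θ w hθ hw.le hwρ.le))
  · rw [norm_div, norm_pow, Complex.norm_real, Real.norm_of_nonneg hw.le,
      div_le_iff₀ (pow_pos hw 2), norm_mul, norm_mul, Complex.norm_real,
      Real.norm_of_nonneg hm.1, mul_assoc (ρ * B), add_mul]
    gcongr
    · exact hB _ hm
    · exact (norm_sub_le _ _).trans (add_le_add (h₄ θ w hθ hm) (h₃ θ w hθ hm))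

/-- The residual vanishes at w = 0 and has w-derivative φ w X with |φ| ≤ v e^θ B: two powers come
from φ w, a third from integration. -/
theorem norm_residualSnd_le (hD : IsDarbouxPair ρ q p ψ) (hK : IsProfile ρ q K)
    (hK' : IsProfile ρ p K') {B A : ℝ} (hB0 : 0 ≤ B) (hB : ∀ r ∈ Icc 0 ρ, ‖ψ r‖ ≤ B) (hA : 0 ≤ A)
    {n : ℕ} {θ w : ℝ} (hθ : 0 ≤ θ) (hw : 0 < w) (hwρ : w * Real.exp θ < ρ)
    (hb : ∀ v ∈ Ioo 0 w, ‖residualFst q p ψ K K' θ v‖ ≤ A * v ^ n) :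
    ‖residualSnd q p ψ K K' θ w‖ ≤ Real.exp θ * B * A * w ^ (n + 3) / (n + 3) := by
  have hS := continuous_charSource hD.continuous_left hK.continuous
  have hS' := continuous_charSource hD.continuous_right hK'.continuous
  have hlt : ∀ v ∈ Ioo 0 w, v * Real.exp θ < ρ := fun v hv =>
    (mul_lt_mul_of_pos_right hv.2 (Real.exp_pos _)).trans hwρ
  have hcont : Continuous (residualSnd q p ψ K K' θ) := by
    have hψ := hD.continuous_log
    have hθc : Continuous fun v : ℝ => (θ, v) := by fun_prop
    have c1 : Continuous (charKernel q K θ) :=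
      (contDiff_one_charSolution hD.continuous_left hS).continuous.comp hθc
    have c2 : Continuous (charKernel p K' θ) :=
      (contDiff_one_charSolution hD.continuous_right hS').continuous.comp hθc
    have c3 := (continuous_integral_right hS).comp hθc
    have c4 := (continuous_integral_right hS').comp hθc
    have c5 : Continuous fun w : ℝ => ((w * Real.exp θ : ℝ) : ℂ) * ψ (w * Real.exp θ) := by
      fun_prop
    exact (c5.mul (c1.add c2)).sub (c3.sub c4)
  have := norm_le_of_norm_deriv_le_pow (n := n + 2) (c := Real.exp θ * B * A) hw (by positivity)
    hcont.continuousOn (by simp [residualSnd])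
    (fun v hv => hD.hasDerivAt_residualSnd hK hK' hθ hv.1 (hlt v hv)) (fun v hv => ?_)
  · refine this.trans (le_of_eq ?_)
    push_cast
    ring_nf
  · have hm : v * Real.exp θ ∈ Icc 0 ρ := ⟨mul_nonneg hv.1.le (Real.exp_pos _).le, (hlt v hv).le⟩
    rw [norm_mul, norm_mul, norm_mul, Complex.norm_real, Complex.norm_real,
      Real.norm_of_nonneg hm.1, Real.norm_of_nonneg hv.1.le]
    have hv0 := hv.1.le
    calc _ ≤ v * Real.exp θ * B * v * (A * v ^ n) := by
          gcongr
          · exact hB _ hm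
          · exact hb v hv
      _ = _ := by ring

theorem residualFst_eq_zero (hρ : 0 < ρ) (hD : IsDarbouxPair ρ q p ψ) (hK : IsProfile ρ q K)
    (hK' : IsProfile ρ p K') {θ w : ℝ} (hθ : 0 ≤ θ) (hw : 0 < w) (hwρ : w * Real.exp θ < ρ) :
    residualFst q p ψ K K' θ w = 0 := by
  obtain ⟨M, hM⟩ := exists_bound_residualFst hρ hD hK hK'
  obtain ⟨B, hB⟩ := isCompact_Icc.exists_bound_of_continuousOn (s := Icc 0 ρ)
    hD.continuous_log.continuousOn
  have hB0 : 0 ≤ B := (norm_nonneg _).trans (hB 0 ⟨le_rfl, hρ.le⟩)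
  have hlt : ∀ {θ₀ θ₁ w : ℝ}, 0 < w → θ₀ ≤ θ₁ → w * Real.exp θ₁ < ρ → w * Real.exp θ₀ < ρ :=
    fun hw h h' => (mul_le_mul_of_nonneg_left (Real.exp_le_exp.2 h) hw.le).trans_lt h'
  -- Restricting to 0 ≤ η ≤ θ bounds e^η by e^θ and the length of the θ-integration by θ, so the
  -- constant does not depend on the point.
  have := eq_zero_of_pow_bound_improves
    (s := {z : ℝ × ℝ | (0 ≤ z.1 ∧ z.1 ≤ θ) ∧ 0 < z.2 ∧ z.2 * Real.exp z.1 < ρ})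
    (N := fun z => ‖residualFst q p ψ K K' z.1 z.2‖) (ℓ := fun z => z.2) (M := M)
    (C := Real.exp θ * B * (Real.exp θ * B) * ρ * θ) (fun _ _ => norm_nonneg _)
    (fun z hz => hM z.1 z.2 hz.1.1 hz.2.1 hz.2.2) ?_ (by positivity) (θ, w) ⟨⟨hθ, le_rfl⟩, hw, hwρ⟩
  · exact norm_eq_zero.1 this
  rintro n A hA hb ⟨θ₁, w⟩ ⟨⟨hθ₁0, hθ₁⟩, hw, hwρ⟩
  simp only at hθ₁0 hθ₁ hw hwρ hb ⊢
  have hwρ' : w < ρ := by simpa using hlt hw hθ₁0 hwρ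
  have hmv := norm_image_sub_le_of_norm_deriv_le_segment' (a := 0) (b := θ₁)
    (f := fun θ => residualFst q p ψ K K' θ w)
    (C := Real.exp θ * B * (Real.exp θ * B) * ρ * A * w ^ (n + 1) / (n + 1))
    (fun η hη => (hD.hasDerivAt_residualFst hK hK' hη.1 hw
      (hlt hw hη.2 hwρ)).hasDerivWithinAt) (fun η hη => ?_) θ₁ ⟨hθ₁0, le_rfl⟩
  · rw [hD.residualFst_zero hw hwρ', sub_zero, sub_zero] at hmv
    refine hmv.trans ?_
    calc _ ≤ Real.exp θ * B * (Real.exp θ * B) * ρ * A * w ^ (n + 1) / (n + 1) * θ := by gcongr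
      _ = _ := by ring
  · have hηρ := hlt hw hη.2.le hwρ
    have hm : w * Real.exp η ∈ Icc 0 ρ := ⟨by positivity, hηρ.le⟩
    have hy := norm_residualSnd_le hD hK hK' hB0 hB hA hη.1 hw hηρ (n := n) fun v hv =>
      hb (η, v) ⟨⟨hη.1, hη.2.le.trans hθ₁⟩, hv.1,
        (mul_lt_mul_of_pos_right hv.2 (Real.exp_pos _)).trans hηρ⟩
    have he : Real.exp η ≤ Real.exp θ := Real.exp_le_exp.2 (hη.2.le.trans hθ₁)
    rw [norm_mul, norm_div, norm_mul, norm_pow, Complex.norm_real, Complex.norm_real,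
      Real.norm_of_nonneg hm.1, Real.norm_of_nonneg hw.le]
    -- The net gain is two powers of w; one is traded for ρ and n + 3 is weakened to n + 1 to fit
    -- the iteration.
    calc _ ≤ w * Real.exp θ * B / w ^ 2 * (Real.exp θ * B * A * w ^ (n + 3) / (n + 1)) := by
          gcongr
          · exact hB _ hm
          · refine hy.trans ?_
            gcongr
            norm_num
      _ = Real.exp θ * B * (Real.exp θ * B) * w * A * w ^ (n + 1) / (n + 1) := by
          field_simp
          ring
      _ ≤ _ := by gcongr

theorem residualSnd_eq_zero (hρ : 0 < ρ) (hD : IsDarbouxPair ρ q p ψ) (hK : IsProfile ρ q K)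
    (hK' : IsProfile ρ p K') {θ w : ℝ} (hθ : 0 ≤ θ) (hw : 0 < w) (hwρ : w * Real.exp θ < ρ) :
    residualSnd q p ψ K K' θ w = 0 := by
  obtain ⟨B, hB⟩ := isCompact_Icc.exists_bound_of_continuousOn (s := Icc 0 ρ)
    hD.continuous_log.continuousOn
  have hB0 : 0 ≤ B := (norm_nonneg _).trans (hB 0 ⟨le_rfl, hρ.le⟩)
  have := norm_residualSnd_le hD hK hK' hB0 hB le_rfl hθ hw hwρ (n := 0) fun v hv => by
    rw [hD.residualFst_eq_zero hρ hK hK' hθ hv.1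
      ((mul_lt_mul_of_pos_right hv.2 (Real.exp_pos _)).trans hwρ)]
    simp
  simpa using this

/-- The first order relation between the kernels of a Darboux pair. -/
theorem hasDerivAt_sq_mul_sub (hρ : 0 < ρ) (hD : IsDarbouxPair ρ q p ψ) (hK : IsProfile ρ q K)
    (hK' : IsProfile ρ p K') {r a : ℝ} (hr : r ∈ Ioo 0 ρ) (ha : a ∈ Ioo (0 : ℝ) 1) :
    HasDerivAt (fun a : ℝ => (a : ℂ) ^ 2 * (K' r a - K r a))
      (2 * a * (r * (profileDeriv p K' r a + ψ r * K' r a))) a := by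
  have hlog : 0 ≤ -Real.log a := neg_nonneg.2 (Real.log_nonpos ha.1.le ha.2.le)
  have ha' : (a : ℂ) ≠ 0 := Complex.ofReal_ne_zero.2 ha.1.ne'
  have hr' : (r : ℂ) ≠ 0 := Complex.ofReal_ne_zero.2 hr.1.ne'
  -- Chain rule at fixed r: ∂_a = -a⁻¹ ∂_θ + r ∂_w.
  have hd : ∀ {q : ℝ → ℂ} {K : ℝ → ℝ → ℂ}, Continuous q → IsProfile ρ q K →
      HasDerivAt (fun a : ℝ => (a : ℂ) ^ 2 * K r a)
        (-a⁻¹ * (∫ v in (0 : ℝ)..(r * a), charSource q K (-Real.log a) v) +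
          r * charSolutionDeriv q (charSource q K) (-Real.log a) (r * a)) a := by
    intro q K hq hK
    have hS := continuous_charSource hq hK.continuous
    have h1 := HasFDerivAt.comp_hasDerivAt a (f := fun a => (-Real.log a, r * a))
      (hasFDerivAt_of_partials (F := charKernel q K) (hasDerivAt_charSolution_fst hS)
        (hasDerivAt_charSolution_snd hq hS) (continuous_integral_right hS)
        (continuous_charSolutionDeriv hq hS) (-Real.log a, r * a))
      ((Real.hasDerivAt_log ha.1.ne').neg.prodMk ((hasDerivAt_id a).const_mul r))
    refine (h1.congr_of_eventuallyEq ?_).congr_deriv ?_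
    · filter_upwards [Ioo_mem_nhds ha.1 ha.2] with b hb
      exact hK.sq_mul_eq (Ioo_subset_Icc_self hr) ⟨hb.1, hb.2.le⟩
    · simp
  have h := (hd hD.continuous_right hK').sub (hd hD.continuous_left hK)
  refine (h.congr_of_eventuallyEq (.of_forall fun b => ?_)).congr_deriv ?_
  · simp only [Pi.sub_apply]; ring
  · have hwρ : r * a * Real.exp (-Real.log a) < ρ := by rw [mul_exp_neg_log ha.1]; exact hr.2
    have h1 := hD.residualFst_eq_zero hρ hK hK' hlog (mul_pos hr.1 ha.1) hwρ
    have h2 := hD.residualSnd_eq_zero hρ hK hK' hlog (mul_pos hr.1 ha.1) hwρ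
    have hKe := hK.sq_mul_eq (Ioo_subset_Icc_self hr) (Ioo_subset_Ioc_self ha)
    have hKe' := hK'.sq_mul_eq (Ioo_subset_Icc_self hr) (Ioo_subset_Ioc_self ha)
    rw [residualFst, mul_exp_neg_log ha.1, ← hKe, ← hKe'] at h1
    rw [residualSnd, mul_exp_neg_log ha.1, ← hKe, ← hKe'] at h2
    rw [profileDeriv]
    push_cast at h1 ⊢
    field_simp at h1 ⊢
    linear_combination -r * a * h1 - h2

end IsDarbouxPair

/-! ### Transmutation operators in terms of profiles -/

/-- The transmutation operator with the kernel written in the variable `σ = √(1 - t)`. -/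
noncomputable def profileOp (K : ℝ → ℝ → ℂ) (h : ℝ → ℂ) (r : ℝ) : ℂ :=
  h r + ∫ σ in (0 : ℝ)..1, (σ : ℂ) * K r σ * h (σ ^ 2 * r)

/-- The continuous extension of `r ↦ (1/r) T[s v(s)](r)` to `r = 0`. -/
noncomputable def reducedOp (K : ℝ → ℝ → ℂ) (v : ℝ → ℂ) (r : ℝ) : ℂ :=
  v r + ∫ σ in (0 : ℝ)..1, (σ : ℂ) ^ 3 * K r σ * v (σ ^ 2 * r)

theorem continuous_profileOp {K : ℝ → ℝ → ℂ} {h : ℝ → ℂ} (hK : Continuous ↿K)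
    (hh : Continuous h) : Continuous (profileOp K h) := by
  have hc : Continuous fun z : ℝ × ℝ => K z.1 z.2 := hK
  refine hh.add (intervalIntegral.continuous_parametric_intervalIntegral_of_continuous'
    (f := fun r σ => (σ : ℂ) * K r σ * h (σ ^ 2 * r)) ?_ 0 1)
  simp only [uncurry_def]
  fun_prop

theorem continuous_reducedOp {K : ℝ → ℝ → ℂ} {h : ℝ → ℂ} (hK : Continuous ↿K)
    (hh : Continuous h) : Continuous (reducedOp K h) := by
  have hc : Continuous fun z : ℝ × ℝ => K z.1 z.2 := hK
  refine hh.add (intervalIntegral.continuous_parametric_intervalIntegral_of_continuous'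
    (f := fun r σ => (σ : ℂ) ^ 3 * K r σ * h (σ ^ 2 * r)) ?_ 0 1)
  simp only [uncurry_def]
  fun_prop

/-- The multiplier evaluated at σ²r is σ² times r: r factors out and σ becomes σ³. Hence the
quotient by s in the representation has no singularity at 0. -/
theorem profileOp_mul_id (K : ℝ → ℝ → ℂ) (v : ℝ → ℂ) (r : ℝ) :
    profileOp K (fun x => x * v x) r = r * reducedOp K v r := by
  rw [profileOp, reducedOp, mul_add, ← intervalIntegral.integral_const_mul]
  congr 2
  ext σ
  push_cast
  ring

theorem IsProfile.zero_left {ρ : ℝ} {q : ℝ → ℂ} {K : ℝ → ℝ → ℂ} (hρ : 0 ≤ ρ)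
    (h : IsProfile ρ q K) {a : ℝ} (ha : a ∈ Icc (0 : ℝ) 1) : K 0 a = 0 := by
  obtain ⟨C, -, hC⟩ := h.bound
  simpa using hC 0 ⟨le_rfl, hρ⟩ a ha

theorem profileOp_zero {ρ : ℝ} {q : ℝ → ℂ} {K : ℝ → ℝ → ℂ} (hρ : 0 ≤ ρ) (h : IsProfile ρ q K)
    (u : ℝ → ℂ) : profileOp K u 0 = u 0 := by
  rw [profileOp, intervalIntegral.integral_congr (g := fun _ => (0 : ℂ))]
  · simp
  · intro σ hσ
    rw [uIcc_of_le zero_le_one] at hσ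
    simp [h.zero_left hρ hσ]

theorem IsProfile.one_right {ρ : ℝ} {q : ℝ → ℂ} {K : ℝ → ℝ → ℂ} (h : IsProfile ρ q K) {r : ℝ}
    (hr : r ∈ Icc 0 ρ) : K r 1 = ∫ v in (0 : ℝ)..r, (v : ℂ) * q v := by
  have := h.eq r hr 0 le_rfl
  simpa [charKernel, goursat] using this

theorem IsProfile.intervalIntegrable_profileDeriv {ρ : ℝ} {q : ℝ → ℂ} {K : ℝ → ℝ → ℂ}
    (hρ : 0 ≤ ρ) (h : IsProfile ρ q K) (hq : Continuous q) {r : ℝ} (hr : r ∈ Icc 0 ρ) :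
    IntervalIntegrable (profileDeriv q K r) volume 0 1 := by
  obtain ⟨C, -, hC⟩ := h.norm_profileDeriv_le hρ hq
  rw [intervalIntegrable_iff_integrableOn_Ioc_of_le zero_le_one]
  refine Integrable.of_bound
    (((continuousOn_profileDeriv hq h.continuous r).mono
      Ioc_subset_Ioi_self).aestronglyMeasurable measurableSet_Ioc) C ?_
  exact ae_restrict_of_forall_mem measurableSet_Ioc fun a ha => hC r hr a ha

theorem IsProfile.hasDerivAt_profileOp {ρ R : ℝ} {p : ℝ → ℂ} {K : ℝ → ℝ → ℂ} {u u' : ℝ → ℂ}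
    (hρ : 0 ≤ ρ) (h : IsProfile ρ p K) (hp : Continuous p) (hR : R ≤ ρ) (hu : Continuous u)
    (hu' : Continuous u') (hd : ∀ x ∈ Ioo 0 R, HasDerivAt u (u' x) x) {r : ℝ}
    (hr : r ∈ Ioo 0 R) :
    HasDerivAt (profileOp K u) (u' r + ∫ σ in (0 : ℝ)..1,
      ((σ : ℂ) * profileDeriv p K r σ * u (σ ^ 2 * r) +
        (σ : ℂ) * K r σ * ((σ ^ 2 : ℝ) • u' (σ ^ 2 * r)))) r := by
  have hKc : Continuous fun z : ℝ × ℝ => K z.1 z.2 := h.continuous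
  obtain ⟨C, hC0, hC⟩ := h.norm_profileDeriv_le hρ hp
  obtain ⟨B, hB⟩ := (isCompact_Icc.prod isCompact_Icc).exists_bound_of_continuousOn
    (s := Icc 0 ρ ×ˢ Icc (0 : ℝ) 1) hKc.continuousOn
  obtain ⟨U, hU⟩ := isCompact_Icc.exists_bound_of_continuousOn (s := Icc 0 ρ) hu.continuousOn
  obtain ⟨V, hV⟩ := isCompact_Icc.exists_bound_of_continuousOn (s := Icc 0 ρ) hu'.continuousOn
  have hU0 : 0 ≤ U := (norm_nonneg _).trans (hU 0 ⟨le_rfl, hρ⟩)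
  have hV0 : 0 ≤ V := (norm_nonneg _).trans (hV 0 ⟨le_rfl, hρ⟩)
  have hB0 : 0 ≤ B := (norm_nonneg _).trans (hB (0, 0) ⟨⟨le_rfl, hρ⟩, by simp⟩)
  have hm : ∀ σ ∈ Ioc (0 : ℝ) 1, ∀ x ∈ Ioo 0 R, σ ^ 2 * x ∈ Ioo 0 R := fun σ hσ x hx =>
    ⟨mul_pos (pow_pos hσ.1 2) hx.1,
      (mul_le_of_le_one_left hx.1.le (pow_le_one₀ hσ.1.le hσ.2)).trans_lt hx.2⟩
  have hRρ : Ioo 0 R ⊆ Icc 0 ρ := fun x hx => ⟨hx.1.le, hx.2.le.trans hR⟩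
  have hRρ' : Ioo 0 R ⊆ Ioo 0 ρ := fun x hx => ⟨hx.1, hx.2.trans_le hR⟩
  refine (hd r hr).add (intervalIntegral.hasDerivAt_integral_of_dominated_loc_of_deriv_le
    (F := fun r σ => (σ : ℂ) * K r σ * u (σ ^ 2 * r)) (F' := fun r σ =>
      (σ : ℂ) * profileDeriv p K r σ * u (σ ^ 2 * r) +
        (σ : ℂ) * K r σ * ((σ ^ 2 : ℝ) • u' (σ ^ 2 * r)))
    (bound := fun _ => 1 * C * U + 1 * B * (1 * V)) (Ioo_mem_nhds hr.1 hr.2)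
    (.of_forall fun x => ?_) ?_ ?_ (.of_forall fun σ hσ x hx => ?_) intervalIntegrable_const
    (.of_forall fun σ hσ x hx => ?_)).2
  · exact Continuous.aestronglyMeasurable (by fun_prop)
  · exact Continuous.intervalIntegrable (by fun_prop) _ _
  · refine AEStronglyMeasurable.add ?_ (Continuous.aestronglyMeasurable (by fun_prop))
    have h1 := (intervalIntegrable_iff.1
      (h.intervalIntegrable_profileDeriv hρ hp (hRρ hr))).aestronglyMeasurable
    have h2 : Continuous fun σ : ℝ => (σ : ℂ) := by fun_prop
    have h3 : Continuous fun σ : ℝ => u (σ ^ 2 * r) := by fun_prop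
    exact (h2.aestronglyMeasurable.mul h1).mul h3.aestronglyMeasurable
  · rw [uIoc_of_le zero_le_one] at hσ
    have h1 : ‖(σ : ℂ)‖ ≤ 1 := by
      rw [Complex.norm_real, Real.norm_of_nonneg hσ.1.le]; exact hσ.2
    have h2 : ‖(σ ^ 2 : ℝ)‖ ≤ 1 := by
      rw [Real.norm_of_nonneg (sq_nonneg _)]; exact pow_le_one₀ hσ.1.le hσ.2
    refine (norm_add_le _ _).trans ?_
    rw [norm_mul, norm_mul, norm_mul, norm_mul, norm_smul]
    gcongr
    · exact hC x (hRρ hx) σ hσ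
    · exact hU _ (hRρ (hm σ hσ x hx))
    · exact hB (x, σ) ⟨hRρ hx, hσ.1.le, hσ.2⟩
    · exact hV _ (hRρ (hm σ hσ x hx))
  · rw [uIoc_of_le zero_le_one] at hσ
    have hlin : HasDerivAt (fun x => σ ^ 2 * x) (σ ^ 2) x := by
      simpa using (hasDerivAt_id x).const_mul (σ ^ 2)
    exact ((h.hasDerivAt hp (hRρ' hx) hσ).const_mul (σ : ℂ)).mul
      (HasDerivAt.scomp x (hd _ (hm σ hσ x hx)) hlin)

/-! ### Integration by parts and the integral representation. -/

namespace IsDarbouxPair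

variable {ρ R : ℝ} {q p ψ : ℝ → ℂ} {K K' : ℝ → ℝ → ℂ} {u u' F : ℝ → ℂ}

theorem integral_by_parts (hρ : 0 < ρ) (hD : IsDarbouxPair ρ q p ψ) (hK : IsProfile ρ q K)
    (hK' : IsProfile ρ p K') (hR : R ≤ ρ) (hu : Continuous u) (hu' : Continuous u')
    (hd : ∀ x ∈ Ioo 0 R, HasDerivAt u (u' x) x) {r : ℝ} (hr : r ∈ Ioo 0 R) :
    (∫ σ in (0 : ℝ)..1, (σ : ℂ) * profileDeriv p K' r σ * u (σ ^ 2 * r)) +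
      ψ r * (∫ σ in (0 : ℝ)..1, (σ : ℂ) * K' r σ * u (σ ^ 2 * r)) +
      (∫ σ in (0 : ℝ)..1, (σ : ℂ) ^ 3 * K' r σ * u' (σ ^ 2 * r)) =
    -ψ r * u r + ∫ σ in (0 : ℝ)..1, (σ : ℂ) ^ 3 * K r σ * u' (σ ^ 2 * r) := by
  have hrρ : r ∈ Ioo 0 ρ := ⟨hr.1, hr.2.trans_le hR⟩
  have hrρ' := Ioo_subset_Icc_self hrρ
  have hr0 : (r : ℂ) ≠ 0 := Complex.ofReal_ne_zero.2 hr.1.ne'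
  have hKc : Continuous fun σ : ℝ => K r σ :=
    hK.continuous.comp (by fun_prop : Continuous fun σ : ℝ => (r, σ))
  have hKc' : Continuous fun σ : ℝ => K' r σ :=
    hK'.continuous.comp (by fun_prop : Continuous fun σ : ℝ => (r, σ))
  have i1 : IntervalIntegrable (fun σ : ℝ => (σ : ℂ) * profileDeriv p K' r σ * u (σ ^ 2 * r))
      volume 0 1 :=
    ((hK'.intervalIntegrable_profileDeriv hρ.le hD.continuous_right hrρ').continuousOn_mul
      (Continuous.continuousOn (by fun_prop : Continuous fun σ : ℝ => (σ : ℂ)))).mul_continuousOn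
      (Continuous.continuousOn (by fun_prop))
  have i2 : IntervalIntegrable (fun σ : ℝ => (σ : ℂ) * K' r σ * u (σ ^ 2 * r)) volume 0 1 :=
    Continuous.intervalIntegrable (by fun_prop) _ _
  have i3 : IntervalIntegrable (fun σ : ℝ => (σ : ℂ) ^ 3 * K' r σ * u' (σ ^ 2 * r)) volume 0 1 :=
    Continuous.intervalIntegrable (by fun_prop) _ _
  have i4 : IntervalIntegrable (fun σ : ℝ => (σ : ℂ) ^ 3 * K r σ * u' (σ ^ 2 * r)) volume 0 1 :=
    Continuous.intervalIntegrable (by fun_prop) _ _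
  -- The first order relation makes the integrand an exact derivative. The boundary term vanishes at
  -- σ = 0; at σ = 1 it is (K' - K)(r, 1) u(r) = -2rψ(r) u(r).
  have hparts := intervalIntegral.integral_eq_sub_of_hasDerivAt_of_le (a := 0) (b := 1)
    (f := fun σ : ℝ => (σ : ℂ) ^ 2 * (K' r σ - K r σ) * u (σ ^ 2 * r))
    (f' := fun σ : ℝ => 2 * r * ((σ : ℂ) * profileDeriv p K' r σ * u (σ ^ 2 * r) +
      ψ r * ((σ : ℂ) * K' r σ * u (σ ^ 2 * r)) + (σ : ℂ) ^ 3 * K' r σ * u' (σ ^ 2 * r) -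
      (σ : ℂ) ^ 3 * K r σ * u' (σ ^ 2 * r))) zero_le_one
    (Continuous.continuousOn (by fun_prop)) (fun σ hσ => ?_)
    ((((i1.add (i2.const_mul _)).add i3).sub i4).const_mul _)
  · rw [intervalIntegral.integral_const_mul,
      intervalIntegral.integral_sub ((i1.add (i2.const_mul _)).add i3) i4,
      intervalIntegral.integral_add (i1.add (i2.const_mul _)) i3,
      intervalIntegral.integral_add i1 (i2.const_mul _), intervalIntegral.integral_const_mul,
      hK.one_right hrρ', hK'.one_right hrρ', hD.integral_sub_eq hrρ'.1 hrρ'.2] at hparts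
    simp only [Complex.ofReal_one, Complex.ofReal_zero, one_pow, one_mul, ne_eq, OfNat.ofNat_ne_zero,
      not_false_eq_true, zero_pow, zero_mul, sub_zero] at hparts
    have h2 : (2 * r : ℂ) ≠ 0 := mul_ne_zero two_ne_zero hr0
    apply mul_left_cancel₀ h2
    linear_combination hparts
  · have hσ2 : σ ^ 2 * r ∈ Ioo 0 R := ⟨mul_pos (pow_pos hσ.1 2) hr.1,
      (mul_le_of_le_one_left hr.1.le (pow_le_one₀ hσ.1.le hσ.2.le)).trans_lt hr.2⟩
    have hlin : HasDerivAt (fun σ : ℝ => σ ^ 2 * r) (2 * σ * r) σ := by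
      simpa using (hasDerivAt_pow 2 σ).mul_const r
    refine ((hD.hasDerivAt_sq_mul_sub hρ hK hK' hrρ hσ).mul
      (HasDerivAt.scomp σ (hd _ hσ2) hlin)).congr_deriv ?_
    simp only [comp_apply, Complex.real_smul]
    push_cast
    ring

/-- The integral representation intertwining the transmutation operators of a Darboux pair. -/
theorem mul_profileOp_eq (hρ : 0 < ρ) (hD : IsDarbouxPair ρ q p ψ) (hK : IsProfile ρ q K)
    (hK' : IsProfile ρ p K') (hF : Continuous F)
    (hFd : ∀ r ∈ Ioo 0 ρ, HasDerivAt F (ψ r * F r) r) (hR : R ≤ ρ) (hu : Continuous u)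
    (hu' : Continuous u') (hd : ∀ x ∈ Ioo 0 R, HasDerivAt u (u' x) x) {r : ℝ}
    (hr : r ∈ Icc 0 R) :
    F r * profileOp K' u r = F 0 * u 0 + ∫ s in (0 : ℝ)..r, F s * reducedOp K u' s := by
  have hc := continuous_reducedOp hK.continuous hu'
  have h := intervalIntegral.integral_eq_sub_of_hasDerivAt_of_le (a := 0) (b := r)
    (f := fun s => F s * profileOp K' u s) (f' := fun s => F s * reducedOp K u' s) hr.1
    (hF.mul (continuous_profileOp hK'.continuous hu)).continuousOn (fun s hs => ?_)
    (Continuous.intervalIntegrable (by fun_prop) _ _)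
  · rw [h, profileOp_zero hρ.le hK']
    ring
  · have hsR : s ∈ Ioo 0 R := ⟨hs.1, hs.2.trans_le hr.2⟩
    have hsρ : s ∈ Ioo 0 ρ := ⟨hsR.1, hsR.2.trans_le hR⟩
    have hKc' : Continuous fun σ : ℝ => K' s σ :=
      hK'.continuous.comp (by fun_prop : Continuous fun σ : ℝ => (s, σ))
    refine ((hFd s hsρ).mul (hK'.hasDerivAt_profileOp hρ.le hD.continuous_right hR hu hu' hd
      hsR)).congr_deriv ?_
    have hbp := hD.integral_by_parts hρ hK hK' hR hu hu' hd hsR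
    rw [intervalIntegral.integral_add, profileOp, reducedOp]
    · have e : ∫ σ in (0 : ℝ)..1, (σ : ℂ) * K' s σ * ((σ ^ 2 : ℝ) • u' (σ ^ 2 * s)) =
          ∫ σ in (0 : ℝ)..1, (σ : ℂ) ^ 3 * K' s σ * u' (σ ^ 2 * s) := by
        congr 1
        ext σ
        rw [Complex.real_smul]
        push_cast
        ring
      rw [e]
      linear_combination F s * hbp
    · exact ((hK'.intervalIntegrable_profileDeriv hρ.le hD.continuous_right
        (Ioo_subset_Icc_self hsρ)).continuousOn_mul
        (Continuous.continuousOn (by fun_prop : Continuous fun σ : ℝ => (σ : ℂ)))).mul_continuousOn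
        (Continuous.continuousOn (by fun_prop))
    · exact Continuous.intervalIntegrable (by fun_prop) _ _

end IsDarbouxPair

/-! ### Existence and uniqueness of the kernel -/

theorem contDiff_one_primitive {g : ℝ → ℂ} (hg : Continuous g) (a : ℝ) :
    ContDiff ℝ 1 fun x => ∫ t in a..x, g t := by
  refine contDiff_one_iff_deriv.2
    ⟨fun x => (hasDerivAt_integral_of_continuous hg a x).differentiableAt, ?_⟩
  rwa [funext fun x => (hasDerivAt_integral_of_continuous hg a x).deriv]

theorem hasDerivAt_derivWithin {u : ℝ → ℂ} {s : Set ℝ} {x : ℝ} (hu : ContDiffOn ℝ 1 u s)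
    (hs : s ∈ 𝓝 x) : HasDerivAt u (derivWithin u s x) x :=
  ((hu.differentiableOn one_ne_zero x (mem_of_mem_nhds hs)).hasDerivWithinAt).hasDerivAt hs

/-- Continue the derivative by its end values outside [0, ρ] and integrate. -/
theorem exists_contDiff_extension {ρ : ℝ} (hρ : 0 < ρ) {q : ℝ → ℂ}
    (hq : ContDiffOn ℝ 1 q (Icc 0 ρ)) : ∃ Q : ℝ → ℂ, ContDiff ℝ 1 Q ∧ ∀ r ∈ Icc 0 ρ, Q r = q r := by
  set d := derivWithin q (Icc 0 ρ) with hd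
  have hdc : Continuous fun x => d (clamp ρ x) := continuous_comp_clamp hρ.le
    (hq.continuousOn_derivWithin (uniqueDiffOn_Icc hρ) le_rfl)
  refine ⟨fun r => q 0 + ∫ t in (0 : ℝ)..r, d (clamp ρ t),
    contDiff_const.add (contDiff_one_primitive hdc 0), fun r hr => ?_⟩
  beta_reduce
  rw [intervalIntegral.integral_eq_sub_of_hasDerivAt_of_le (f := q) hr.1
    (hq.continuousOn.mono (Icc_subset_Icc_right hr.2)) (fun x hx => ?_)
    (hdc.intervalIntegrable _ _)]
  · ring
  · have hx' : x ∈ Ioo 0 ρ := ⟨hx.1, hx.2.trans_le hr.2⟩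
    rw [clamp_of_mem (Ioo_subset_Icc_self hx')]
    exact hasDerivAt_derivWithin hq (Icc_mem_nhds hx'.1 hx'.2)

theorem IsTransmutationKernel.congr {ρ : ℝ} {q p : ℝ → ℂ} {G : ℝ → ℝ → ℂ}
    (h : IsTransmutationKernel ρ q G) (hqp : ∀ r ∈ Icc 0 ρ, q r = p r) :
    IsTransmutationKernel ρ p G where
  continuousOn := h.continuousOn
  contDiffOn := h.contDiffOn
  pde r hr t ht := by rw [← hqp r (Ioo_subset_Icc_self hr)]; exact h.pde r hr t ht
  initial_t r hr := by
    rw [h.initial_t r hr]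
    refine intervalIntegral.integral_congr fun τ hτ => ?_
    rw [uIcc_of_le hr.1] at hτ
    simp only [hqp τ ⟨hτ.1, hτ.2.trans hr.2⟩]
  initial_r := h.initial_r

theorem kernelWellPosed {ρ : ℝ} (hρ : 0 < ρ) {q : ℝ → ℂ} (hq : ContDiffOn ℝ 1 q (Icc 0 ρ)) :
    KernelWellPosed ρ q := by
  obtain ⟨Q, hQ, hQq⟩ := exists_contDiff_extension hρ hq
  obtain ⟨K, hK⟩ := exists_isProfile hρ.le hQ.continuous
  exact ⟨⟨_, (hK.isTransmutationKernel hρ.le hQ).congr hQq⟩,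
    fun G H hG hH => hG.eqOn hρ hq.continuousOn hH⟩

/-- Uniqueness identifies the chosen kernel with K(r, √(1 - t)), and t = 1 - σ² turns the root into
σ. -/
theorem transmutation_eq_profileOp {ρ : ℝ} (hρ : 0 < ρ) {q Q : ℝ → ℂ} {K : ℝ → ℝ → ℂ}
    (hq : ContDiffOn ℝ 1 q (Icc 0 ρ)) (hQ : ContDiff ℝ 1 Q) (hQq : ∀ r ∈ Icc 0 ρ, Q r = q r)
    (hK : IsProfile ρ Q K) (h : ℝ → ℂ) {r : ℝ} (hr : r ∈ Icc 0 ρ) :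
    transmutation ρ q h r = profileOp K h r := by
  have hG := (hK.isTransmutationKernel hρ.le hQ).congr hQq
  have hex : ∃ G, IsTransmutationKernel ρ q G := ⟨_, hG⟩
  rw [transmutation, profileOp]
  congr 1
  refine intervalIntegral.integral_congr fun σ hσ => ?_
  rw [uIcc_of_le zero_le_one] at hσ
  have h2 := pow_le_one₀ hσ.1 hσ.2 (n := 2)
  have := hex.choose_spec.eqOn hρ hq.continuousOn hG r hr (1 - σ ^ 2)
    ⟨by linarith, by linarith [sq_nonneg σ]⟩
  simp only [kernel, dif_pos hex, this, sub_sub_cancel, Real.sqrt_sq hσ.1]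

theorem profileOp_congr {ρ r : ℝ} {K : ℝ → ℝ → ℂ} {h h' : ℝ → ℂ}
    (hh : ∀ x ∈ Icc 0 ρ, h x = h' x) (hr : r ∈ Icc 0 ρ) : profileOp K h r = profileOp K h' r := by
  rw [profileOp, profileOp, hh r hr]
  congr 1
  refine intervalIntegral.integral_congr fun σ hσ => ?_
  rw [uIcc_of_le zero_le_one] at hσ
  have h2 := pow_le_one₀ hσ.1 hσ.2 (n := 2)
  simp only [hh (σ ^ 2 * r) ⟨mul_nonneg (sq_nonneg _) hr.1,
    (mul_le_of_le_one_left hr.1 h2).trans hr.2⟩]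

/-! ### The intertwining relations -/

/-- Potentials `q`, `p` on `[0, ρ]` exchanged by the Darboux transform generated by `f`, with
extensions to the line and profiles of their kernels. -/
structure IsDarbouxTransform (ρ : ℝ) (f q p F Q P ψ : ℝ → ℂ) (K K' : ℝ → ℝ → ℂ) : Prop where
  pos : 0 < ρ
  contDiffOn_left : ContDiffOn ℝ 1 q (Icc 0 ρ)
  contDiffOn_right : ContDiffOn ℝ 1 p (Icc 0 ρ)
  contDiff_left : ContDiff ℝ 1 Q
  contDiff_right : ContDiff ℝ 1 P
  left_eq : ∀ r ∈ Icc 0 ρ, Q r = q r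
  right_eq : ∀ r ∈ Icc 0 ρ, P r = p r
  pair : IsDarbouxPair ρ Q P ψ
  profile_left : IsProfile ρ Q K
  profile_right : IsProfile ρ P K'
  contDiffOn : ContDiffOn ℝ 1 f (Icc 0 ρ)
  ne_zero : ∀ r, F r ≠ 0
  at_zero : f 0 = 1
  continuous : Continuous F
  eq : ∀ r ∈ Icc 0 ρ, F r = f r
  hasDerivAt : ∀ r ∈ Ioo 0 ρ, HasDerivAt F (ψ r * F r) r

namespace IsDarbouxTransform

variable {ρ R : ℝ} {f q p F Q P ψ : ℝ → ℂ} {K K' : ℝ → ℝ → ℂ}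

theorem symm (h : IsDarbouxTransform ρ f q p F Q P ψ K K') :
    IsDarbouxTransform ρ (fun r => 1 / f r) p q (fun r => 1 / F r) P Q (fun r => -ψ r) K' K where
  pos := h.pos
  contDiffOn_left := h.contDiffOn_right
  contDiffOn_right := h.contDiffOn_left
  contDiff_left := h.contDiff_right
  contDiff_right := h.contDiff_left
  left_eq := h.right_eq
  right_eq := h.left_eq
  pair := h.pair.symm
  profile_left := h.profile_right
  profile_right := h.profile_left
  contDiffOn := by
    simp only [one_div]
    exact h.contDiffOn.inv fun r hr => by rw [← h.eq r hr]; exact h.ne_zero r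
  ne_zero r := one_div_ne_zero (h.ne_zero r)
  at_zero := by rw [h.at_zero, one_div_one]
  continuous := continuous_const.div h.continuous h.ne_zero
  eq r hr := by rw [h.eq r hr]
  hasDerivAt r hr := by
    have := (h.hasDerivAt r hr).inv (h.ne_zero r)
    refine (this.congr_deriv ?_).congr_of_eventuallyEq (.of_forall fun x => by simp)
    have := h.ne_zero r
    field_simp

variable {u v U V : ℝ → ℂ}

theorem mul_transmutation_eq (h : IsDarbouxTransform ρ f q p F Q P ψ K K') (hR0 : 0 ≤ R)
    (hR : R ≤ ρ) (hU : Continuous U) (hV : Continuous V)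
    (hd : ∀ x ∈ Ioo 0 R, HasDerivAt U (V x) x) (hu : ∀ x ∈ Icc 0 R, u x = U x) {r : ℝ}
    (hr : r ∈ Icc 0 R) :
    f r * transmutation ρ p u r = u 0 + ∫ s in (0 : ℝ)..r, F s * reducedOp K V s := by
  have hr' : r ∈ Icc 0 ρ := ⟨hr.1, hr.2.trans hR⟩
  rw [transmutation_eq_profileOp h.pos h.contDiffOn_right h.contDiff_right h.right_eq
    h.profile_right u hr', profileOp_congr hu hr, ← h.eq r hr', hu 0 ⟨le_rfl, hR0⟩,
    h.pair.mul_profileOp_eq h.pos h.profile_left h.profile_right h.continuous h.hasDerivAt hR hU hV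
    hd hr, h.eq 0 ⟨le_rfl, h.pos.le⟩, h.at_zero, one_mul]

theorem transmutation_mul_id (h : IsDarbouxTransform ρ f q p F Q P ψ K K') (hR : R ≤ ρ)
    (hv : ∀ x ∈ Icc 0 R, v x = V x) {r : ℝ} (hr : r ∈ Icc 0 R) :
    transmutation ρ q (fun x => x * v x) r = r * reducedOp K V r := by
  rw [transmutation_eq_profileOp h.pos h.contDiffOn_left h.contDiff_left h.left_eq
    h.profile_left _ ⟨hr.1, hr.2.trans hR⟩, ← profileOp_mul_id]
  exact profileOp_congr (fun x hx => by rw [hv x hx]) hr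

theorem representation (h : IsDarbouxTransform ρ f q p F Q P ψ K K') (hR0 : 0 ≤ R)
    (hR : R ≤ ρ) (hU : Continuous U) (hV : Continuous V)
    (hd : ∀ x ∈ Ioo 0 R, HasDerivAt U (V x) x) (hu : ∀ x ∈ Icc 0 R, u x = U x)
    (hv : ∀ x ∈ Icc 0 R, v x = V x) {r : ℝ} (hr : r ∈ Icc 0 R) :
    IntervalIntegrable (fun s : ℝ => f s * transmutation ρ q (fun x => x * v x) s / s) volume 0 r ∧
      transmutation ρ p u r = 1 / f r *
        ((∫ s in (0 : ℝ)..r, f s * transmutation ρ q (fun x => x * v x) s / s) + u 0) := by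
  have hc : Continuous fun s => F s * reducedOp K V s :=
    h.continuous.mul (continuous_reducedOp h.profile_left.continuous hV)
  have heq : ∀ s ∈ uIoc 0 r, F s * reducedOp K V s =
      f s * transmutation ρ q (fun x => x * v x) s / s := by
    intro s hs
    rw [uIoc_of_le hr.1] at hs
    have hsR : s ∈ Icc 0 R := ⟨hs.1.le, hs.2.trans hr.2⟩
    have hs0 : (s : ℂ) ≠ 0 := Complex.ofReal_ne_zero.2 hs.1.ne'
    rw [h.transmutation_mul_id hR hv hsR, h.eq s ⟨hsR.1, hsR.2.trans hR⟩]
    field_simp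
  refine ⟨(hc.intervalIntegrable 0 r).congr heq, ?_⟩
  have hf : f r ≠ 0 := by rw [← h.eq r ⟨hr.1, hr.2.trans hR⟩]; exact h.ne_zero r
  rw [← intervalIntegral.integral_congr_ae (.of_forall heq), one_div, eq_inv_mul_iff_mul_eq₀ hf,
    h.mul_transmutation_eq hR0 hR hU hV hd hu hr, add_comm]

/-- Clamping to [0, R] may create corners at 0 and R, which is why differentiability is required
only in the open interval. -/
theorem exists_extension (hu : ContDiffOn ℝ 1 u (Ico 0 ρ)) (hR0 : 0 < R) (hR : R < ρ) :
    ∃ U V : ℝ → ℂ, Continuous U ∧ Continuous V ∧ (∀ x ∈ Ioo 0 R, HasDerivAt U (V x) x) ∧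
      (∀ x ∈ Icc 0 R, u x = U x) ∧ ∀ x ∈ Icc 0 R, derivWithin u (Ico 0 ρ) x = V x := by
  have hsub : Icc 0 R ⊆ Ico 0 ρ := fun x hx => ⟨hx.1, hx.2.trans_lt hR⟩
  have hρ : 0 < ρ := hR0.trans hR
  refine ⟨fun x => u (clamp R x), fun x => derivWithin u (Ico 0 ρ) (clamp R x),
    continuous_comp_clamp hR0.le (hu.continuousOn.mono hsub), continuous_comp_clamp hR0.le
      ((hu.continuousOn_derivWithin (uniqueDiffOn_Ico 0 ρ) le_rfl).mono hsub), fun x hx => ?_,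
    fun x hx => by beta_reduce; rw [clamp_of_mem hx],
    fun x hx => by beta_reduce; rw [clamp_of_mem hx]⟩
  beta_reduce
  rw [clamp_of_mem (Ioo_subset_Icc_self hx)]
  refine (hasDerivAt_derivWithin hu (Ico_mem_nhds hx.1 (hx.2.trans hR))).congr_of_eventuallyEq ?_
  filter_upwards [Ioo_mem_nhds hx.1 hx.2] with y hy
  rw [clamp_of_mem (Ioo_subset_Icc_self hy)]

theorem representation_of_contDiffOn (h : IsDarbouxTransform ρ f q p F Q P ψ K K')
    (hu : ContDiffOn ℝ 1 u (Ico 0 ρ)) {r : ℝ} (hr : r ∈ Ico 0 ρ) :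
    IntervalIntegrable (fun s : ℝ => f s * transmutation ρ q
        (fun x => x * derivWithin u (Ico 0 ρ) x) s / s) volume 0 r ∧
      transmutation ρ p u r = 1 / f r * ((∫ s in (0 : ℝ)..r, f s * transmutation ρ q
        (fun x => x * derivWithin u (Ico 0 ρ) x) s / s) + u 0) := by
  -- Since u may be unbounded near ρ, a smaller radius is used; the operators at r see u only on [0,
  -- r].
  obtain ⟨R, hrR, hRρ⟩ := exists_between hr.2
  have hR0 : 0 < R := hr.1.trans_lt hrR
  obtain ⟨U, V, hU, hV, hd, huU, hvV⟩ := exists_extension hu hR0 hRρ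
  exact h.representation hR0.le hRρ.le hU hV hd huU hvV ⟨hr.1, hrR.le⟩

/-- After multiplication by f the function is a constant plus a primitive of a continuous function,
so r = 0 needs no separate argument. -/
theorem contDiffOn_transmutation (h : IsDarbouxTransform ρ f q p F Q P ψ K K')
    (hu : ContDiffOn ℝ 1 u (Ico 0 ρ)) : ContDiffOn ℝ 1 (transmutation ρ p u) (Ico 0 ρ) := by
  intro r hr
  obtain ⟨R, hrR, hRρ⟩ := exists_between hr.2
  have hR0 : 0 < R := hr.1.trans_lt hrR
  obtain ⟨U, V, hU, hV, hd, huU, -⟩ := exists_extension hu hR0 hRρ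
  have hc : Continuous fun s => F s * reducedOp K V s :=
    h.continuous.mul (continuous_reducedOp h.profile_left.continuous hV)
  have hsub : Icc 0 R ⊆ Icc 0 ρ := Icc_subset_Icc_right hRρ.le
  have hne : ∀ s ∈ Icc 0 R, f s ≠ 0 := fun s hs => by
    rw [← h.eq s (hsub hs)]; exact h.ne_zero s
  have hcd : ContDiffOn ℝ 1 (fun r => (f r)⁻¹ * (u 0 + ∫ s in (0 : ℝ)..r, F s * reducedOp K V s))
      (Icc 0 R) :=
    ((h.contDiffOn.mono hsub).inv hne).mul
      (contDiff_const.add (contDiff_one_primitive hc 0)).contDiffOn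
  refine ((hcd.congr fun s hs => ?_) r ⟨hr.1, hrR.le⟩).mono_of_mem_nhdsWithin ?_
  · rw [eq_inv_mul_iff_mul_eq₀ (hne s hs), h.mul_transmutation_eq hR0.le hRρ.le hU hV hd huU hs]
  · filter_upwards [self_mem_nhdsWithin, mem_nhdsWithin_of_mem_nhds (Iio_mem_nhds hrR)] with s h1 h2
    exact ⟨h1.1, le_of_lt h2⟩

theorem darbouxD_transmutation (h : IsDarbouxTransform ρ f q p F Q P ψ K K')
    (hu : ContDiffOn ℝ 1 u (Ico 0 ρ)) {r : ℝ} (hr : r ∈ Ico 0 ρ) :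
    darbouxD ρ f (transmutation ρ p u) r = transmutation ρ q (darbouxD ρ (fun _ => 1) u) r := by
  obtain ⟨R, hrR, hRρ⟩ := exists_between hr.2
  have hR0 : 0 < R := hr.1.trans_lt hrR
  obtain ⟨U, V, hU, hV, hd, huU, hvV⟩ := exists_extension hu hR0 hRρ
  have hc : Continuous fun s => F s * reducedOp K V s :=
    h.continuous.mul (continuous_reducedOp h.profile_left.continuous hV)
  have hrR' : r ∈ Icc 0 R := ⟨hr.1, hrR.le⟩
  have hf : f r ≠ 0 := by rw [← h.eq r ⟨hr.1, hr.2.le⟩]; exact h.ne_zero r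
  have heq : ∀ s ∈ Icc 0 R, f s * transmutation ρ p u s =
      u 0 + ∫ s in (0 : ℝ)..s, F s * reducedOp K V s := fun s hs =>
    h.mul_transmutation_eq hR0.le hRρ.le hU hV hd huU hs
  have hder : HasDerivWithinAt (fun s => f s * transmutation ρ p u s) (F r * reducedOp K V r)
      (Ico 0 ρ) r := by
    refine (((hasDerivAt_integral_of_continuous hc 0 r).const_add
      (u 0)).hasDerivWithinAt).congr_of_eventuallyEq ?_ (heq r hrR')
    filter_upwards [self_mem_nhdsWithin, mem_nhdsWithin_of_mem_nhds (Iio_mem_nhds hrR)] with s h1 h2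
    exact heq s ⟨h1.1, le_of_lt h2⟩
  have hD1 : darbouxD ρ (fun _ => 1) u = fun x : ℝ => x * derivWithin u (Ico 0 ρ) x := by
    ext x
    simp [darbouxD]
  rw [darbouxD, hder.derivWithin (uniqueDiffOn_Ico 0 ρ r hr), hD1,
    h.transmutation_mul_id hRρ.le hvV hrR', h.eq r ⟨hr.1, hr.2.le⟩]
  field_simp

end IsDarbouxTransform

/-- With ψ = f'/f the radial equation becomes (rψ)' = r(q - ψ²), and the definition of the
transformed potential is q + p = 2ψ². Clamping f keeps it continuous and nonzero on the whole line.
-/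
theorem exists_isDarbouxTransform {ρ : ℝ} (hρ : 0 < ρ) {q f : ℝ → ℂ}
    (hq : ContDiffOn ℝ 1 q (Icc 0 ρ)) (hf : ContDiffOn ℝ 2 f (Icc 0 ρ))
    (hf_ne : ∀ r ∈ Icc 0 ρ, f r ≠ 0)
    (hf_eq : ∀ r ∈ Ioo 0 ρ, deriv (deriv f) r + deriv f r / (r : ℂ) - q r * f r = 0)
    (hf_zero : f 0 = 1) :
    ∃ (F Q P ψ : ℝ → ℂ) (K K' : ℝ → ℝ → ℂ),
      IsDarbouxTransform ρ f q (darbouxPotential ρ f q) F Q P ψ K K' := by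
  set d := derivWithin f (Icc 0 ρ) with hd_def
  have hd : ContDiffOn ℝ 1 d (Icc 0 ρ) :=
    hf.derivWithin (uniqueDiffOn_Icc hρ) (by norm_num [one_add_one_eq_two])
  have hf1 : ContDiffOn ℝ 1 f (Icc 0 ρ) := hf.of_le (by norm_num)
  have hp : ContDiffOn ℝ 1 (darbouxPotential ρ f q) (Icc 0 ρ) := by
    have : ContDiffOn ℝ 1 (fun r => 2 * (d r * (f r)⁻¹) ^ 2 - q r) (Icc 0 ρ) :=
      (contDiffOn_const.mul ((hd.mul (hf1.inv hf_ne)).pow 2)).sub hq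
    exact this
  have hfd : ∀ r ∈ Ioo 0 ρ, HasDerivAt f (d r) r := fun r hr =>
    hasDerivAt_derivWithin hf1 (Icc_mem_nhds hr.1 hr.2)
  have hdd : ∀ r ∈ Ioo 0 ρ, HasDerivAt d (q r * f r - d r / (r : ℂ)) r := fun r hr => by
    have h1 := hasDerivAt_derivWithin hd (Icc_mem_nhds hr.1 hr.2)
    have h2 : deriv f =ᶠ[𝓝 r] d := by
      filter_upwards [Ioo_mem_nhds hr.1 hr.2] with x hx using (hfd x hx).deriv
    refine h1.congr_deriv ?_
    have h3 := hf_eq r hr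
    rw [h2.deriv_eq, h2.eq_of_nhds, h1.deriv] at h3
    linear_combination h3
  obtain ⟨Q, hQ, hQq⟩ := exists_contDiff_extension hρ hq
  obtain ⟨P, hP, hPp⟩ := exists_contDiff_extension hρ hp
  obtain ⟨K, hK⟩ := exists_isProfile hρ.le hQ.continuous
  obtain ⟨K', hK'⟩ := exists_isProfile hρ.le hP.continuous
  have hFc := continuous_comp_clamp hρ.le hf.continuousOn
  have hFne : ∀ r, f (clamp ρ r) ≠ 0 := fun r => hf_ne _ (clamp_mem hρ.le r)
  have hev : ∀ r ∈ Ioo 0 ρ, ∀ᶠ x in 𝓝 r, clamp ρ x = x := fun r hr => by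
    filter_upwards [Ioo_mem_nhds hr.1 hr.2] with x hx using clamp_of_mem (Ioo_subset_Icc_self hx)
  refine ⟨fun r => f (clamp ρ r), Q, P, fun r => d (clamp ρ r) / f (clamp ρ r), K, K',
    { pos := hρ, contDiffOn_left := hq, contDiffOn_right := hp, contDiff_left := hQ,
      contDiff_right := hP, left_eq := hQq, right_eq := hPp, pair := ?_, profile_left := hK,
      profile_right := hK', contDiffOn := hf1, ne_zero := hFne, at_zero := hf_zero,
      continuous := hFc, eq := fun r hr => by rw [clamp_of_mem hr], hasDerivAt := ?_ }⟩
  · refine ⟨hQ.continuous, hP.continuous,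
      (continuous_comp_clamp hρ.le hd.continuousOn).div hFc hFne, fun r hr => ?_, fun r hr => ?_⟩
    · rw [hQq r hr, hPp r hr, clamp_of_mem hr, darbouxPotential]
      ring
    · have hr' := Ioo_subset_Icc_self hr
      have hfr := hf_ne r hr'
      have hr0 : (r : ℂ) ≠ 0 := Complex.ofReal_ne_zero.2 hr.1.ne'
      rw [clamp_of_mem hr', hQq r hr']
      refine (((hasDerivAt_id r).ofReal_comp.mul ((hdd r hr).div (hfd r hr)
        hfr)).congr_of_eventuallyEq ?_).congr_deriv ?_
      · filter_upwards [hev r hr] with x hx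
        simp [hx]
      · simp only [id, Complex.ofReal_one, Pi.div_apply]
        field_simp
        ring
  · intro r hr
    rw [clamp_of_mem (Ioo_subset_Icc_self hr), div_mul_cancel₀ _ (hf_ne r (Ioo_subset_Icc_self hr))]
    refine (hfd r hr).congr_of_eventuallyEq ?_
    filter_upwards [hev r hr] with x hx
    rw [hx]

end RadialVekua

theorem mainTheorem5 (ρ : ℝ) (hρ : 0 < ρ) (q f : ℝ → ℂ)
    (hq : ContDiffOn ℝ 1 q (Set.Icc 0 ρ))
    (hf : ContDiffOn ℝ 2 f (Set.Icc 0 ρ))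
    (hf_ne : ∀ r ∈ Set.Icc 0 ρ, f r ≠ 0)
    (hf_eq : ∀ r ∈ Set.Ioo 0 ρ, deriv (deriv f) r + deriv f r / (r : ℂ) - q r * f r = 0)
    (hf_zero : f 0 = 1) :
    -- the kernels of `T_f` and `T_{1/f}` exist and are unique
    RadialVekua.KernelWellPosed ρ q ∧
    RadialVekua.KernelWellPosed ρ (RadialVekua.darbouxPotential ρ f q) ∧
    -- the representation of `T_{1/f}` on polynomials, on the closed interval
    (∀ p : Polynomial ℂ, ∀ r ∈ Set.Icc 0 ρ,
      IntervalIntegrable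
        (fun s : ℝ => f s * RadialVekua.transmutation ρ q
          (fun x : ℝ => (x : ℂ) * (Polynomial.derivative p).eval (x : ℂ)) s / (s : ℂ))
        MeasureTheory.volume 0 r ∧
      RadialVekua.transmutation ρ (RadialVekua.darbouxPotential ρ f q)
          (fun x : ℝ => p.eval (x : ℂ)) r =
        1 / f r * ((∫ s in (0 : ℝ)..r, f s * RadialVekua.transmutation ρ q
          (fun x : ℝ => (x : ℂ) * (Polynomial.derivative p).eval (x : ℂ)) s / (s : ℂ))
          + p.eval 0)) ∧
    ∀ u : ℝ → ℂ, ContDiffOn ℝ 1 u (Set.Ico 0 ρ) →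
      -- the representation of `T_{1/f}` on `C¹[0, ρ)`
      (∀ r ∈ Set.Ico 0 ρ,
        IntervalIntegrable
          (fun s : ℝ => f s * RadialVekua.transmutation ρ q
            (fun x : ℝ => (x : ℂ) * derivWithin u (Set.Ico 0 ρ) x) s / (s : ℂ))
          MeasureTheory.volume 0 r ∧
        RadialVekua.transmutation ρ (RadialVekua.darbouxPotential ρ f q) u r =
          1 / f r * ((∫ s in (0 : ℝ)..r, f s * RadialVekua.transmutation ρ q
            (fun x : ℝ => (x : ℂ) * derivWithin u (Set.Ico 0 ρ) x) s / (s : ℂ)) + u 0)) ∧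
      -- `T_f` and `T_{1/f}` preserve `C¹[0, ρ)`
      ContDiffOn ℝ 1 (RadialVekua.transmutation ρ q u) (Set.Ico 0 ρ) ∧
      ContDiffOn ℝ 1
        (RadialVekua.transmutation ρ (RadialVekua.darbouxPotential ρ f q) u) (Set.Ico 0 ρ) ∧
      -- `D_f T_{1/f} u = T_f D_1 u` and `D_{1/f} T_f u = T_{1/f} D_1 u`
      (∀ r ∈ Set.Ico 0 ρ,
        RadialVekua.darbouxD ρ f
            (RadialVekua.transmutation ρ (RadialVekua.darbouxPotential ρ f q) u) r =
          RadialVekua.transmutation ρ q (RadialVekua.darbouxD ρ (fun _ => 1) u) r) ∧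
      (∀ r ∈ Set.Ico 0 ρ,
        RadialVekua.darbouxD ρ (fun x => 1 / f x) (RadialVekua.transmutation ρ q u) r =
          RadialVekua.transmutation ρ (RadialVekua.darbouxPotential ρ f q)
            (RadialVekua.darbouxD ρ (fun _ => 1) u) r) := by
  obtain ⟨F, Q, P, ψ, K, K', h⟩ :=
    RadialVekua.exists_isDarbouxTransform hρ hq hf hf_ne hf_eq hf_zero
  refine ⟨RadialVekua.kernelWellPosed hρ hq, RadialVekua.kernelWellPosed hρ h.contDiffOn_right,
    fun p r hr => ?_, fun u hu => ⟨fun r hr => h.representation_of_contDiffOn hu hr,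
      h.symm.contDiffOn_transmutation hu, h.contDiffOn_transmutation hu,
      fun r hr => h.darbouxD_transmutation hu hr,
      fun r hr => h.symm.darbouxD_transmutation hu hr⟩⟩
  -- Polynomials are differentiable on the whole line, so R = ρ is allowed and the endpoint r = ρ is
  -- included.
  have hpd : ∀ x : ℝ, HasDerivAt (fun x : ℝ => p.eval (x : ℂ))
      ((Polynomial.derivative p).eval (x : ℂ)) x := fun x => (p.hasDerivAt (x : ℂ)).comp_ofReal
  simpa using h.representation (u := fun x : ℝ => p.eval (x : ℂ))
    (v := fun x : ℝ => (Polynomial.derivative p).eval (x : ℂ)) hρ.le le_rfl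
    (p.continuous.comp Complex.continuous_ofReal)
    ((Polynomial.derivative p).continuous.comp Complex.continuous_ofReal)
    (fun x _ => hpd x) (fun _ _ => rfl) (fun _ _ => rfl) hr
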